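/- For $x,y\in\{0,1\}^n$ and an integer $d\ge 0$, let $\mathsf{HAM}_n^d(x,y)=1$ if $x$ and $y$ differ in at most $d$ positions, and $\mathsf{HAM}_n^d(x,y)=0$ otherwise. Let $v_0,\dots,v_r$ be a path of length $r\ge 1$, whose left end $v_0$ holds $x\in\{0,1\}^n$, whose right end $v_r$ holds $y\in\{0,1\}^n$, and whose other nodes have no input. A distributed quantum Merlin-Arthur (dQMA) protocol on this path works as follows. A prover sends a quantum certificate to each node; the joint state of the certificates is arbitrary and may be entangled. Then every node, depending only on its own input, applies a local quantum operation to its certificate (with private ancillas and private randomness; there is no shared randomness and no other shared entanglement) which produces one quantum message for each of its neighbours and a private memory. All messages are delivered simultaneously. Finally every node accepts or rejects according to a binary measurement, depending only on its own input, of its private memory and of the messages it received. The protocol has completeness $a$ and soundness $b$ for $f\colon\{0,1\}^n\times\{0,1\}^n\to\{0,1\}$ if for all $x,y\in\{0,1\}^n$: when $f(x,y)=1$, the prover can choose the certificates so that all nodes accept with probability at least $a$; when $f(x,y)=0$, for all certificates, all nodes accept with probability at most $b$. **Corollary.** For every real $c>0$ and every integer $d>0$ there is a constant $C=C(c,d)>0$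 such that for all $n\ge 1$ and $r\ge 1$ there exists a dQMA protocol for $\mathsf{HAM}_n^d$ on the path of length $r$, with completeness $1-1/n^c$ and soundness $1/3$, in which every certificate, and every message sent from a node to a neighbour, consists of at most $C\,r^2(\log n)\log(n+r)$ qubits. -/

import Mathlib

open scoped ComplexOrder

noncomputable section

/-- Bit strings of length `n`. -/
abbrev BitString (n : ℕ) : Type := Fin n → Bool

/-- The standard basis of a register of `k` qubits: the state space of the register
is the space of complex vectors indexed by `QReg k`. -/
abbrev QReg (k : ℕ) : Type := Fin k → Bool

/-- The Hamming distance function: `1` iff `x` and `y` differ in at most `d` positions. -/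
def HAM (n d : ℕ) (x y : BitString n) : Bool := decide (hammingDist x y ≤ d)

/-- Density matrices (mixed quantum states) over the standard basis `ι`. -/
def IsDensityMatrix {ι : Type*} [Fintype ι] (ρ : Matrix ι ι ℂ) : Prop :=
  ρ.PosSemidef ∧ ρ.trace = 1

/-- `E` is the accepting element of a binary POVM `{E, 1 - E}`. -/
def IsEffect {ι : Type*} [Fintype ι] [DecidableEq ι] (E : Matrix ι ι ℂ) : Prop :=
  E.PosSemidef ∧ (1 - E).PosSemidef

/-- A one-round distributed quantum Merlin-Arthur verification protocol on the network `G`,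
where every node gets a local input from `I`.

Every node `v` receives a certificate of `certSize v` qubits from the prover.  It then prepares its
messages: depending only on its local input, it applies an isometry (a unitary on the certificate
and fresh ancillas) from the certificate to its private memory together with one outgoing message
register of `msgSize v w` qubits for every node `w`; non-adjacent nodes exchange nothing.
The messages are delivered simultaneously.  Finally `v` measures, with a binary POVM depending only
on its local input, its private memory together with all the messages it received.

The private memory is any finite-dimensional space (with basis `Mem v`), so that private
randomness, intermediate measurements and arbitrary local channels are covered by dilation. There is
neither shared randomness nor entanglement shared between the nodes, besides what is in the
certificates. -/
structure DQMAProtocol {V : Type*} [Fintype V] [DecidableEq V] (G : SimpleGraph V)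
    (I : Type*) where
  /-- number of qubits of the certificate of a node -/
  certSize : V → ℕ
  /-- number of qubits of the message from the first node to the second one -/
  msgSize : V → V → ℕ
  msgSize_eq_zero : ∀ u v, ¬ G.Adj u v → msgSize u v = 0
  /-- basis of the private memory of a node -/
  Mem : V → Type
  [fintypeMem : ∀ v, Fintype (Mem v)]
  [decidableEqMem : ∀ v, DecidableEq (Mem v)]
  /-- local operation before the communication -/
  prep : (v : V) → I → Matrix (Mem v × ((w : V) → QReg (msgSize v w))) (QReg (certSize v)) ℂ
  prep_isometry : ∀ v i, (prep v i).conjTranspose * prep v i = 1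
  /-- accepting POVM element of a node after the communication -/
  accept : (v : V) → I → Matrix (Mem v × ((u : V) → QReg (msgSize u v)))
    (Mem v × ((u : V) → QReg (msgSize u v))) ℂ
  accept_isEffect : ∀ v i, IsEffect (accept v i)

namespace DQMAProtocol

attribute [instance] DQMAProtocol.fintypeMem DQMAProtocol.decidableEqMem

variable {V : Type*} [Fintype V] [DecidableEq V] {G : SimpleGraph V} {I : Type*}

/-- Basis of the joint space of all certificates. -/
abbrev Certs (P : DQMAProtocol G I) : Type _ := (v : V) → QReg (P.certSize v)

/-- Basis of the joint space of all private memories and all messages; in `(m, t)`, the content of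
the message from `u` to `v` is `t u v`. -/
abbrev Config (P : DQMAProtocol G I) : Type _ :=
  ((v : V) → P.Mem v) × ((u v : V) → QReg (P.msgSize u v))

/-- The tensor product of the local operations of all the nodes. Node `v` owns, before the
communication, its memory and all the registers of messages from `v`. -/
def globalPrep (P : DQMAProtocol G I) (inp : V → I) : Matrix P.Config P.Certs ℂ :=
  Matrix.of fun s z => ∏ v, P.prep v (inp v) (s.1 v, s.2 v) (z v)

/-- The tensor product of the accepting POVM elements of all the nodes, i.e. the effect
"all nodes accept". Node `v` owns, after the communication, its memory and all the registers of
messages to `v`. -/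
def globalAccept (P : DQMAProtocol G I) (inp : V → I) : Matrix P.Config P.Config ℂ :=
  Matrix.of fun s s' =>
    ∏ v, P.accept v (inp v) (s.1 v, fun u => s.2 u v) (s'.1 v, fun u => s'.2 u v)

/-- The probability that all nodes accept, when the local inputs are `inp` and the (possibly
entangled) certificates sent by the prover are in the joint state `ρ`. -/
def acceptProb (P : DQMAProtocol G I) (inp : V → I) (ρ : Matrix P.Certs P.Certs ℂ) : ℝ :=
  (Matrix.trace (P.globalAccept inp *
    (P.globalPrep inp * ρ * (P.globalPrep inp).conjTranspose))).re

end DQMAProtocol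

/-- The local inputs on the path `v_0, …, v_r`: the left end gets `x`, the right end gets `y`, and
the intermediate nodes get no input. -/
def pathInput {n r : ℕ} (x y : BitString n) (v : Fin (r + 1)) : Option (BitString n) :=
  if v = 0 then some x else if v = Fin.last r then some y else none

/-- `P` is a distributed quantum Merlin-Arthur protocol for `f` on the path of length `r`, with
completeness `a` and soundness `b`. -/
def IsDQMAOnPath {n r : ℕ}
    (P : DQMAProtocol (SimpleGraph.pathGraph (r + 1)) (Option (BitString n)))
    (f : BitString n → BitString n → Bool) (a b : ℝ) : Prop :=
  ∀ x y : BitString n,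
    (f x y = true → ∃ ρ, IsDensityMatrix ρ ∧ a ≤ P.acceptProb (pathInput x y) ρ) ∧
    (f x y = false → ∀ ρ, IsDensityMatrix ρ → P.acceptProb (pathInput x y) ρ ≤ b)

end

/-! The protocol is a parallel repetition of one round built on fingerprints. The fingerprint `ψ x`
is a uniform superposition over seeds `s` in `ZMod p` of the pair of `s` and the polynomial hash of
`x`; `D y` collects the pairs of a seed and the hash of a string within distance `d` of `y`. If `x`
is close to `y`, measuring `ψ x` always lands in `D y`. Otherwise a union bound over the Hamming
ball gives probability at most 1/4, with only `O(d log n)` qubits (`exists_hamming_fingerprint`).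

In a round, every node gets two registers, supposedly two copies of `ψ x`. The left end checks that
its second register is `ψ x`, the right end that its first one lies in `D y`, and an inner node
projects its pair onto the symmetric subspace. Each node keeps the first register and sends the
second to the right, and every node but the left end runs a swap test on the kept and received
registers. Honest certificates pass with certainty (`oneRound_complete`), which is more than the
completeness asked for.

For soundness, let `Ψ` be the unnormalised state after the local checks succeed, and `η` its
distance to the range of the projection "all swap tests pass". Exchanging registers across an edge
moves `Ψ` by at most `2η`, exchanging the two registers of an inner node not at all. Composing these
along the path moves the fingerprint of the left end into the register tested by the right end at
cost `2rη`; yet the two states differ by at least half the norm of `Ψ`. Hence `‖Ψ‖ ≤ 4rη`, so a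
round accepts with probability at most `1 - 1/(16r²)` (`oneRound_sound`).

This is an operator inequality on the certificates, so it tensorises and entanglement between rounds
does not help (`parallel_acceptProb_le`). With `32r²` rounds the error is at most `e⁻² ≤ 1/3`, using
`O(r² log n)` qubits. -/

noncomputable section

open Matrix

/-! ### Tensor products of finite families of matrices and vectors. -/

section PiKron

variable {V : Type*} [Fintype V] {ι κ μ : V → Type*}

/-- The tensor product of a finite family of matrices. -/
def piKron (A : ∀ v, Matrix (ι v) (κ v) ℂ) : Matrix (∀ v, ι v) (∀ v, κ v) ℂ :=
  Matrix.of fun s z => ∏ v, A v (s v) (z v)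

/-- The tensor product of a finite family of vectors. -/
def piVec (φ : ∀ v, ι v → ℂ) : (∀ v, ι v) → ℂ := fun z => ∏ v, φ v (z v)

lemma piKron_apply (A : ∀ v, Matrix (ι v) (κ v) ℂ) (s z) :
    piKron A s z = ∏ v, A v (s v) (z v) := rfl

lemma piKron_conjTranspose (A : ∀ v, Matrix (ι v) (κ v) ℂ) :
    (piKron A)ᴴ = piKron fun v => (A v)ᴴ := by
  ext s z
  simp [piKron_apply, Matrix.conjTranspose_apply]

lemma piKron_one [∀ v, DecidableEq (ι v)] :
    piKron (fun v => (1 : Matrix (ι v) (ι v) ℂ)) = 1 := by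
  ext s z
  rw [piKron_apply, Matrix.one_apply]
  split_ifs with h
  · exact Finset.prod_eq_one fun v _ => by rw [h, Matrix.one_apply_eq]
  · obtain ⟨v, hv⟩ := Function.ne_iff.mp h
    exact Finset.prod_eq_zero (Finset.mem_univ v) (Matrix.one_apply_ne hv)

lemma star_piVec (φ : ∀ v, ι v → ℂ) : star (piVec φ) = piVec fun v => star (φ v) := by
  ext z
  simp [piVec]

variable [DecidableEq V]

lemma piKron_mul [∀ v, Fintype (κ v)] (A : ∀ v, Matrix (ι v) (κ v) ℂ)
    (B : ∀ v, Matrix (κ v) (μ v) ℂ) :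
    piKron A * piKron B = piKron fun v => A v * B v := by
  ext s z
  simp only [piKron_apply, Matrix.mul_apply]
  rw [Finset.prod_univ_sum, Fintype.piFinset_univ]
  simp [Finset.prod_mul_distrib]

lemma piKron_mulVec_piVec [∀ v, Fintype (κ v)] (A : ∀ v, Matrix (ι v) (κ v) ℂ)
    (φ : ∀ v, κ v → ℂ) :
    piKron A *ᵥ piVec φ = piVec fun v => A v *ᵥ φ v := by
  ext s
  simp only [piVec, Matrix.mulVec, dotProduct, piKron_apply]
  rw [Finset.prod_univ_sum, Fintype.piFinset_univ]
  simp [Finset.prod_mul_distrib]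

lemma piVec_dotProduct_piVec [∀ v, Fintype (ι v)] (φ χ : ∀ v, ι v → ℂ) :
    piVec φ ⬝ᵥ piVec χ = ∏ v, φ v ⬝ᵥ χ v := by
  simp only [piVec, dotProduct]
  rw [Finset.prod_univ_sum, Fintype.piFinset_univ]
  simp [Finset.prod_mul_distrib]

open scoped MatrixOrder in
lemma Matrix.PosSemidef.exists_eq_conjTranspose_mul_self {n : Type*} [Fintype n]
    {A : Matrix n n ℂ} (hA : A.PosSemidef) : ∃ B : Matrix n n ℂ, A = Bᴴ * B := by
  classical
  exact CStarAlgebra.nonneg_iff_eq_star_mul_self.mp hA.nonneg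

lemma piKron_posSemidef [∀ v, Fintype (ι v)] {A : ∀ v, Matrix (ι v) (ι v) ℂ}
    (hA : ∀ v, (A v).PosSemidef) : (piKron A).PosSemidef := by
  choose B hB using fun v => (hA v).exists_eq_conjTranspose_mul_self
  have h : piKron A = (piKron B)ᴴ * piKron B := by
    rw [piKron_conjTranspose, piKron_mul]
    exact congrArg piKron (funext hB)
  rw [h]
  exact Matrix.posSemidef_conjTranspose_mul_self _

/-- The tensor product is monotone on positive semidefinite matrices. -/
lemma piKron_sub_posSemidef [∀ v, Fintype (ι v)] {A B : ∀ v, Matrix (ι v) (ι v) ℂ}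
    (hA : ∀ v, (A v).PosSemidef) (hAB : ∀ v, (B v - A v).PosSemidef) :
    (piKron B - piKron A).PosSemidef := by
  classical
  have hB : ∀ v, (B v).PosSemidef := fun v => by
    simpa using (hAB v).add (hA v)
  -- Hybrid argument: the factors are changed from `B` to `A` one at a time, and each change lowers
  -- the product by a tensor product of positive semidefinite matrices.
  suffices h : ∀ S : Finset V,
      (piKron B - piKron fun v => if v ∈ S then A v else B v).PosSemidef by
    simpa using h Finset.univ
  intro S
  induction S using Finset.induction_on with
  | empty => simpa using Matrix.PosSemidef.zero
  | insert v S hv ih =>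
    have key : (piKron fun u => if u ∈ S then A u else B u) -
        (piKron fun u => if u ∈ insert v S then A u else B u) =
        piKron fun u => if u = v then B u - A u else if u ∈ S then A u else B u := by
      ext s z
      simp only [Matrix.sub_apply, piKron_apply]
      rw [← Finset.mul_prod_erase _ _ (Finset.mem_univ v),
        ← Finset.mul_prod_erase _ _ (Finset.mem_univ v),
        ← Finset.mul_prod_erase Finset.univ (fun u => (if u = v then B u - A u else
          if u ∈ S then A u else B u) (s u) (z u)) (Finset.mem_univ v)]
      have h1 : ∀ u ∈ Finset.univ.erase v, (if u ∈ insert v S then A u else B u) (s u) (z u) =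
          (if u ∈ S then A u else B u) (s u) (z u) := fun u hu => by
        simp [Finset.ne_of_mem_erase hu]
      have h2 : ∀ u ∈ Finset.univ.erase v, (if u = v then B u - A u else
          if u ∈ S then A u else B u) (s u) (z u) =
          (if u ∈ S then A u else B u) (s u) (z u) := fun u hu => by
        simp [Finset.ne_of_mem_erase hu]
      rw [Finset.prod_congr rfl h1, Finset.prod_congr rfl h2]
      simp [hv, sub_mul]
    have h3 : (piKron fun u => if u = v then B u - A u else
        if u ∈ S then A u else B u).PosSemidef := piKron_posSemidef fun u => by
      split_ifs
      exacts [hAB u, hA u, hB u]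
    have := ih.add h3
    rw [← key] at this
    simpa using this

lemma piKron_isEffect [∀ v, Fintype (ι v)] [∀ v, DecidableEq (ι v)]
    {A : ∀ v, Matrix (ι v) (ι v) ℂ} (hA : ∀ v, IsEffect (A v)) : IsEffect (piKron A) := by
  refine ⟨piKron_posSemidef fun v => (hA v).1, ?_⟩
  rw [← piKron_one]
  exact piKron_sub_posSemidef (fun v => (hA v).1) fun v => (hA v).2

end PiKron

lemma IsEffect.submatrix {ι κ : Type*} [Fintype ι] [DecidableEq ι] [Fintype κ] [DecidableEq κ]
    {E : Matrix ι ι ℂ} (hE : IsEffect E) (e : κ ≃ ι) : IsEffect (E.submatrix e e) := by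
  refine ⟨hE.1.submatrix e, ?_⟩
  have := hE.2.submatrix e
  rwa [Matrix.submatrix_sub, Pi.sub_apply, Pi.sub_apply, Matrix.submatrix_one_equiv] at this

lemma isEffect_of_isHermitian_of_mul_self {ι : Type*} [Fintype ι] [DecidableEq ι]
    {E : Matrix ι ι ℂ} (h1 : Eᴴ = E) (h2 : E * E = E) : IsEffect E := by
  constructor
  · have := Matrix.posSemidef_conjTranspose_mul_self E
    rwa [h1, h2] at this
  · have := Matrix.posSemidef_conjTranspose_mul_self (1 - E)
    rwa [Matrix.conjTranspose_sub, Matrix.conjTranspose_one, h1, sub_mul, mul_sub, mul_sub, h2,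
      one_mul, mul_one, one_mul, sub_self, sub_zero] at this

lemma Matrix.PosSemidef.trace_mul_re_nonneg {ι : Type*} [Fintype ι] {A B : Matrix ι ι ℂ}
    (hA : A.PosSemidef) (hB : B.PosSemidef) : 0 ≤ (A * B).trace.re := by
  obtain ⟨R, rfl⟩ := hB.exists_eq_conjTranspose_mul_self
  rw [← mul_assoc, Matrix.trace_mul_comm, ← mul_assoc]
  exact (Complex.nonneg_iff.mp (hA.mul_mul_conjTranspose_same R).trace_nonneg).1

/-! ### Acceptance as an observable on the certificates. -/

namespace DQMAProtocol

variable {V : Type*} [Fintype V] [DecidableEq V] {G : SimpleGraph V} {I : Type*}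

/-- Basis of the registers owned by a node before the communication. -/
abbrev Out (P : DQMAProtocol G I) (v : V) : Type _ := P.Mem v × ((w : V) → QReg (P.msgSize v w))

/-- Basis of the registers owned by a node after the communication. -/
abbrev In (P : DQMAProtocol G I) (v : V) : Type _ := P.Mem v × ((u : V) → QReg (P.msgSize u v))

/-- A configuration, grouped by owners before the communication. -/
def outEquiv (P : DQMAProtocol G I) : P.Config ≃ ((v : V) → P.Out v) where
  toFun s v := (s.1 v, s.2 v)
  invFun s := (fun v => (s v).1, fun v => (s v).2)
  left_inv _ := rfl
  right_inv _ := rfl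

/-- A configuration, grouped by owners after the communication. -/
def inEquiv (P : DQMAProtocol G I) : P.Config ≃ ((v : V) → P.In v) where
  toFun s v := (s.1 v, fun u => s.2 u v)
  invFun s := (fun v => (s v).1, fun u v => (s v).2 u)
  left_inv _ := rfl
  right_inv _ := rfl

lemma globalPrep_eq (P : DQMAProtocol G I) (inp : V → I) :
    P.globalPrep inp = (piKron fun v => P.prep v (inp v)).submatrix P.outEquiv (Equiv.refl _) := rfl

lemma globalAccept_eq (P : DQMAProtocol G I) (inp : V → I) :
    P.globalAccept inp = (piKron fun v => P.accept v (inp v)).submatrix P.inEquiv P.inEquiv := rfl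

lemma globalPrep_isometry (P : DQMAProtocol G I) (inp : V → I) :
    (P.globalPrep inp)ᴴ * P.globalPrep inp = 1 := by
  rw [globalPrep_eq, Matrix.conjTranspose_submatrix, Matrix.submatrix_mul_equiv,
    piKron_conjTranspose, piKron_mul]
  simp only [P.prep_isometry, piKron_one]
  simp

lemma globalAccept_isEffect (P : DQMAProtocol G I) (inp : V → I) :
    IsEffect (P.globalAccept inp) := by
  rw [globalAccept_eq]
  exact (piKron_isEffect fun v => P.accept_isEffect v (inp v)).submatrix P.inEquiv

/-- The effect "all nodes accept" as an observable of the certificates. -/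
def acceptOp (P : DQMAProtocol G I) (inp : V → I) : Matrix P.Certs P.Certs ℂ :=
  (P.globalPrep inp)ᴴ * P.globalAccept inp * P.globalPrep inp

lemma acceptOp_posSemidef (P : DQMAProtocol G I) (inp : V → I) :
    (P.acceptOp inp).PosSemidef :=
  (P.globalAccept_isEffect inp).1.conjTranspose_mul_mul_same _

lemma acceptProb_eq (P : DQMAProtocol G I) (inp : V → I) (ρ : Matrix P.Certs P.Certs ℂ) :
    P.acceptProb inp ρ = (P.acceptOp inp * ρ).trace.re := by
  rw [acceptProb, acceptOp, ← Matrix.mul_assoc, Matrix.trace_mul_comm]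
  simp only [Matrix.mul_assoc]

/-- An operator bound controls all certificates at once, entangled or not; soundness is always
proved in this form. -/
lemma acceptProb_le (P : DQMAProtocol G I) (inp : V → I) {l : ℝ}
    (h : ((l : ℂ) • 1 - P.acceptOp inp).PosSemidef) {ρ : Matrix P.Certs P.Certs ℂ}
    (hρ : IsDensityMatrix ρ) : P.acceptProb inp ρ ≤ l := by
  have := h.trace_mul_re_nonneg hρ.1
  rw [sub_mul, Matrix.trace_sub, Complex.sub_re, smul_mul_assoc, one_mul, Matrix.trace_smul, hρ.2,
    ← acceptProb_eq] at this
  simpa using this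

lemma exists_acceptProb_eq_one (P : DQMAProtocol G I) (inp : V → I) {φ : P.Certs → ℂ}
    (hφ : star φ ⬝ᵥ φ = 1) (h : P.acceptOp inp *ᵥ φ = φ) :
    ∃ ρ, IsDensityMatrix ρ ∧ P.acceptProb inp ρ = 1 := by
  refine ⟨Matrix.vecMulVec φ (star φ), ⟨Matrix.posSemidef_vecMulVec_self_star φ, ?_⟩, ?_⟩
  · rw [Matrix.trace_vecMulVec, dotProduct_comm, hφ]
  · rw [acceptProb_eq, Matrix.mul_vecMulVec, h, Matrix.trace_vecMulVec, dotProduct_comm, hφ,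
      Complex.one_re]

end DQMAProtocol

/-! ### Parallel repetition. -/

/-- A register of `k * m` qubits consists of `k` registers of `m` qubits. -/
def regEquiv (k m : ℕ) : QReg (k * m) ≃ (Fin k → QReg m) :=
  (Equiv.arrowCongr finProdFinEquiv.symm (Equiv.refl Bool)).trans (Equiv.curry _ _ _)

namespace DQMAProtocol

variable {V : Type*} [Fintype V] [DecidableEq V] {G : SimpleGraph V} {I : Type*}

/-- A memory with messages of `k` parallel rounds, grouped by rounds. -/
def roundsEquiv {k : ℕ} {M : Type} (m : V → ℕ) :
    ((Fin k → M) × ((w : V) → QReg (k * m w))) ≃ (Fin k → M × ((w : V) → QReg (m w))) where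
  toFun s j := (s.1 j, fun w => regEquiv k (m w) (s.2 w) j)
  invFun s := (fun j => (s j).1, fun w => (regEquiv k (m w)).symm fun j => (s j).2 w)
  left_inv s := by simp
  right_inv s := by simp

/-- The `k`-fold parallel repetition of a protocol. -/
def parallel (P : DQMAProtocol G I) (k : ℕ) : DQMAProtocol G I where
  certSize v := k * P.certSize v
  msgSize u v := k * P.msgSize u v
  msgSize_eq_zero u v h := by rw [P.msgSize_eq_zero u v h, mul_zero]
  Mem v := Fin k → P.Mem v
  prep v i := (piKron fun _ : Fin k => P.prep v i).submatrix
    (roundsEquiv (P.msgSize v)) (regEquiv k (P.certSize v))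
  prep_isometry v i := by
    rw [Matrix.conjTranspose_submatrix, Matrix.submatrix_mul_equiv, piKron_conjTranspose,
      piKron_mul]
    simp only [P.prep_isometry, piKron_one, Matrix.submatrix_one_equiv]
  accept v i := (piKron fun _ : Fin k => P.accept v i).submatrix
    (roundsEquiv fun u => P.msgSize u v) (roundsEquiv fun u => P.msgSize u v)
  accept_isEffect v i := (piKron_isEffect fun _ => P.accept_isEffect v i).submatrix _

variable (P : DQMAProtocol G I) (k : ℕ)

/-- The certificates of a parallel repetition, grouped by rounds. -/
def parallelCerts : (P.parallel k).Certs ≃ (Fin k → P.Certs) where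
  toFun z j v := regEquiv k (P.certSize v) (z v) j
  invFun z v := (regEquiv k (P.certSize v)).symm fun j => z j v
  left_inv z := by
    funext v
    exact (regEquiv k (P.certSize v)).symm_apply_apply (z v)
  right_inv z := by ext; simp

/-- The configurations of a parallel repetition, grouped by rounds. -/
def parallelConfig : (P.parallel k).Config ≃ (Fin k → P.Config) where
  toFun s j := (fun v => s.1 v j, fun u v => regEquiv k (P.msgSize u v) (s.2 u v) j)
  invFun s := (fun v j => (s j).1 v, fun u v =>
    (regEquiv k (P.msgSize u v)).symm fun j => (s j).2 u v)
  left_inv s := by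
    refine Prod.ext rfl ?_
    funext u v
    exact (regEquiv k (P.msgSize u v)).symm_apply_apply (s.2 u v)
  right_inv s := by simp

lemma parallel_globalPrep (inp : V → I) : (P.parallel k).globalPrep inp =
    (piKron fun _ : Fin k => P.globalPrep inp).submatrix
      (P.parallelConfig k) (P.parallelCerts k) := by
  ext s z
  exact Finset.prod_comm (s := Finset.univ) (t := Finset.univ) (f := fun v (j : Fin k) =>
    P.prep v (inp v) (P.outEquiv (P.parallelConfig k s j) v) (P.parallelCerts k z j v))

lemma parallel_globalAccept (inp : V → I) : (P.parallel k).globalAccept inp =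
    (piKron fun _ : Fin k => P.globalAccept inp).submatrix
      (P.parallelConfig k) (P.parallelConfig k) := by
  ext s z
  exact Finset.prod_comm (s := Finset.univ) (t := Finset.univ) (f := fun v (j : Fin k) =>
    P.accept v (inp v) (P.inEquiv (P.parallelConfig k s j) v)
      (P.inEquiv (P.parallelConfig k z j) v))

/-- Both global operators are double products over nodes and rounds; exchanging the two products
exhibits a tensor power. -/
lemma parallel_acceptOp (inp : V → I) : (P.parallel k).acceptOp inp =
    (piKron fun _ : Fin k => P.acceptOp inp).submatrix
      (P.parallelCerts k) (P.parallelCerts k) := by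
  rw [acceptOp, parallel_globalPrep, parallel_globalAccept, Matrix.conjTranspose_submatrix,
    Matrix.submatrix_mul_equiv, Matrix.submatrix_mul_equiv, piKron_conjTranspose, piKron_mul,
    piKron_mul]
  rfl

/-- Tensor products are monotone on positive semidefinite matrices, so the bound `l` on one round is
raised to the power `k` even for certificates entangled across rounds. -/
lemma parallel_acceptProb_le (inp : V → I) {l : ℝ}
    (h : ((l : ℂ) • 1 - P.acceptOp inp).PosSemidef)
    {ρ : Matrix (P.parallel k).Certs (P.parallel k).Certs ℂ} (hρ : IsDensityMatrix ρ) :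
    (P.parallel k).acceptProb inp ρ ≤ l ^ k := by
  refine acceptProb_le _ _ ?_ hρ
  have h1 := piKron_sub_posSemidef (V := Fin k) (fun _ => P.acceptOp_posSemidef inp) fun _ => h
  have h2 : piKron (fun _ : Fin k => (l : ℂ) • (1 : Matrix P.Certs P.Certs ℂ)) =
      ((l ^ k : ℝ) : ℂ) • 1 := by
    rw [← piKron_one (ι := fun _ : Fin k => P.Certs)]
    ext s z
    simp only [piKron_apply, Matrix.smul_apply, smul_eq_mul, Finset.prod_mul_distrib]
    simp
  rw [h2] at h1
  have h3 := h1.submatrix (P.parallelCerts k)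
  rw [parallel_acceptOp]
  convert h3 using 1
  rw [Matrix.submatrix_sub, Pi.sub_apply, Pi.sub_apply, Matrix.submatrix_smul, Pi.smul_apply,
    Pi.smul_apply, Matrix.submatrix_one_equiv]

lemma parallel_exists_acceptProb_eq_one (inp : V → I) {φ : P.Certs → ℂ}
    (hφ : star φ ⬝ᵥ φ = 1) (h : P.acceptOp inp *ᵥ φ = φ) :
    ∃ ρ, IsDensityMatrix ρ ∧ (P.parallel k).acceptProb inp ρ = 1 := by
  refine exists_acceptProb_eq_one _ _ (φ := piVec (fun _ : Fin k => φ) ∘ P.parallelCerts k) ?_ ?_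
  · have h1 : star (piVec (fun _ : Fin k => φ)) ⬝ᵥ piVec (fun _ : Fin k => φ) = 1 := by
      rw [star_piVec, piVec_dotProduct_piVec]
      simp [hφ]
    rw [← h1]
    exact Fintype.sum_equiv (P.parallelCerts k) _ _ fun _ => rfl
  · rw [parallel_acceptOp, Matrix.submatrix_mulVec_equiv, Function.comp_assoc,
      Equiv.self_comp_symm, Function.comp_id, piKron_mulVec_piVec]
    simp only [h]

end DQMAProtocol

/-! ### Norm estimates for vectors of amplitudes. -/

section L2

variable {X : Type*} [Fintype X]

/-- The Euclidean norm of a vector of amplitudes. -/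
def l2norm (Ψ : X → ℂ) : ℝ := ‖WithLp.toLp 2 Ψ‖

lemma l2norm_nonneg (Ψ : X → ℂ) : 0 ≤ l2norm Ψ := norm_nonneg _

lemma l2norm_sq (Ψ : X → ℂ) : l2norm Ψ ^ 2 = ∑ s, ‖Ψ s‖ ^ 2 :=
  EuclideanSpace.norm_sq_eq _

lemma l2norm_add_le (Ψ Φ : X → ℂ) : l2norm (Ψ + Φ) ≤ l2norm Ψ + l2norm Φ := by
  simp only [l2norm, WithLp.toLp_add]
  exact norm_add_le _ _

lemma l2norm_sub_le (Ψ Φ : X → ℂ) : l2norm (Ψ - Φ) ≤ l2norm Ψ + l2norm Φ := by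
  simp only [l2norm, WithLp.toLp_sub]
  exact norm_sub_le _ _

lemma l2norm_comp_perm (Ψ : X → ℂ) (π : Equiv.Perm X) : l2norm (Ψ ∘ π) = l2norm Ψ := by
  rw [← sq_eq_sq₀ (l2norm_nonneg _) (l2norm_nonneg _), l2norm_sq, l2norm_sq]
  exact Equiv.sum_comp π fun s => ‖Ψ s‖ ^ 2

lemma l2norm_le_of_norm_le {Ψ Φ : X → ℂ} (h : ∀ s, ‖Ψ s‖ ≤ ‖Φ s‖) : l2norm Ψ ≤ l2norm Φ := by
  rw [← sq_le_sq₀ (l2norm_nonneg _) (l2norm_nonneg _), l2norm_sq, l2norm_sq]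
  exact Finset.sum_le_sum fun s _ => pow_le_pow_left₀ (norm_nonneg _) (h s) 2

lemma star_dotProduct_self_eq (Ψ : X → ℂ) : star Ψ ⬝ᵥ Ψ = ((l2norm Ψ ^ 2 : ℝ) : ℂ) := by
  rw [l2norm_sq]
  simp [dotProduct, ← Complex.conj_mul']

lemma star_dotProduct_mulVec_of_projection {G : Matrix X X ℂ} (hG : Gᴴ = G) (hGG : G * G = G)
    (Ψ : X → ℂ) : star Ψ ⬝ᵥ (G *ᵥ Ψ) = ((l2norm (G *ᵥ Ψ) ^ 2 : ℝ) : ℂ) := by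
  rw [← star_dotProduct_self_eq, Matrix.star_mulVec, hG, Matrix.dotProduct_mulVec,
    ← Matrix.dotProduct_mulVec, ← Matrix.dotProduct_mulVec, Matrix.mulVec_mulVec, hGG]

lemma l2norm_sub_projection_sq {G : Matrix X X ℂ} (hG : Gᴴ = G) (hGG : G * G = G)
    (Ψ : X → ℂ) : l2norm (Ψ - G *ᵥ Ψ) ^ 2 = l2norm Ψ ^ 2 - l2norm (G *ᵥ Ψ) ^ 2 := by
  classical
  have h1 : (1 - G)ᴴ = 1 - G := by rw [Matrix.conjTranspose_sub, Matrix.conjTranspose_one, hG]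
  have h2 : (1 - G) * (1 - G) = 1 - G := by
    rw [sub_mul, mul_sub, mul_sub, hGG, one_mul, mul_one, one_mul, sub_self, sub_zero]
  have h3 := star_dotProduct_mulVec_of_projection h1 h2 Ψ
  have h4 := star_dotProduct_mulVec_of_projection hG hGG Ψ
  rw [Matrix.sub_mulVec, Matrix.one_mulVec, dotProduct_sub, star_dotProduct_self_eq, h4] at h3
  exact_mod_cast h3.symm

lemma l2norm_mulVec_isometry {Y : Type*} [Fintype Y] [DecidableEq X] {W : Matrix Y X ℂ}
    (hW : Wᴴ * W = 1) (φ : X → ℂ) : l2norm (W *ᵥ φ) = l2norm φ := by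
  rw [← sq_eq_sq₀ (l2norm_nonneg _) (l2norm_nonneg _)]
  have h : star (W *ᵥ φ) ⬝ᵥ (W *ᵥ φ) = star φ ⬝ᵥ φ := by
    rw [Matrix.star_mulVec, ← Matrix.dotProduct_mulVec, Matrix.mulVec_mulVec, hW,
      Matrix.one_mulVec]
  rw [star_dotProduct_self_eq, star_dotProduct_self_eq] at h
  exact_mod_cast h

/-- If the register `c₀` is in the state `ψ`, and the register `c₁` is supported on a set of small
`ψ`-mass, then moving the contents of `c₀` to `c₁` changes the state a lot. -/
lemma l2norm_le_two_mul_of_moved {α : Type*} [Fintype α] [DecidableEq α] {Ψ : X → ℂ}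
    {ψ : α → ℂ} {D : Finset α} {c₀ c₁ : X → α} {put : X → α → X}
    (hput : ∀ s b, c₀ (put s b) = b) (hput' : ∀ s b, put (put s b) (c₀ s) = s)
    (hfac : ∀ s b b', ψ b' * Ψ (put s b) = ψ b * Ψ (put s b'))
    (hψ : ∑ a, ‖ψ a‖ ^ 2 = 1) (hD : ∑ a ∈ D, ‖ψ a‖ ^ 2 ≤ 1 / 4)
    (hsupp : ∀ s, Ψ s ≠ 0 → c₁ s ∈ D) {π : Equiv.Perm X} (hπ : ∀ s, c₀ (π s) = c₁ s) :
    l2norm Ψ ≤ 2 * l2norm (Ψ ∘ π - Ψ) := by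
  -- Trading the contents of `c₀` for an independent `b` is an involution, so averaging over
  -- overwritten configurations amounts to averaging over all configurations.
  let move : X × α ≃ X × α := Function.Involutive.toPerm (fun q => (put q.1 q.2, c₀ q.1))
    fun q => by simp [hput, hput']
  have hregroup : ∀ f : X → ℝ, ∑ s, ∑ b, f (put s b) = Fintype.card α * ∑ s, f s := by
    intro f
    rw [← Fintype.sum_prod_type' fun s b => f (put s b)]
    refine (Equiv.sum_comp move fun q => f q.1).trans ?_
    rw [Fintype.sum_prod_type, Finset.mul_sum]
    simp
  -- By `hfac`, on each fibre of configurations differing only in `c₀` the distribution of `c₀` is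
  -- that of `ψ`, so the event `c₀ ∈ D` has relative mass at most 1/4.
  have hmass : ∑ s, (if c₀ s ∈ D then ‖Ψ s‖ ^ 2 else 0) ≤ 1 / 4 * l2norm Ψ ^ 2 := by
    rcases isEmpty_or_nonempty X with hX | ⟨⟨s₀⟩⟩
    · simp [l2norm_sq]
    have hcard : (0 : ℝ) < Fintype.card α :=
      Nat.cast_pos.mpr (Fintype.card_pos_iff.mpr ⟨c₀ s₀⟩)
    rw [← mul_le_mul_iff_right₀ hcard, l2norm_sq, mul_left_comm, ← hregroup, ← hregroup,
      Finset.mul_sum]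
    refine Finset.sum_le_sum fun s _ => ?_
    have h1 : ∀ b, ‖Ψ (put s b)‖ ^ 2 = ‖ψ b‖ ^ 2 * ∑ b', ‖Ψ (put s b')‖ ^ 2 := by
      intro b
      rw [← one_mul (‖Ψ (put s b)‖ ^ 2), ← hψ, Finset.sum_mul, Finset.mul_sum]
      refine Finset.sum_congr rfl fun b' _ => ?_
      rw [← mul_pow, ← mul_pow, ← norm_mul, ← norm_mul, hfac]
    simp only [hput]
    rw [← Finset.sum_filter, Finset.filter_mem_eq_inter, Finset.univ_inter,
      Finset.sum_congr rfl fun b _ => h1 b, ← Finset.sum_mul]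
    exact mul_le_mul_of_nonneg_right hD (Finset.sum_nonneg fun _ _ => sq_nonneg _)
  -- The part of the permuted state with `c₁ ∈ D`. It has norm at most `‖Ψ‖ / 2`, and since `Ψ`
  -- lives on `c₁ ∈ D`, passing to this part only decreases the distance to `Ψ`.
  let Φ : X → ℂ := fun s => if c₁ s ∈ D then Ψ (π s) else 0
  have h1 : l2norm Φ ≤ 1 / 2 * l2norm Ψ := by
    rw [← sq_le_sq₀ (l2norm_nonneg _) (by have := l2norm_nonneg Ψ; positivity), l2norm_sq, mul_pow]
    refine le_trans (le_of_eq ?_) (hmass.trans (by norm_num))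
    refine Eq.trans ?_ (Equiv.sum_comp π fun s => if c₀ s ∈ D then ‖Ψ s‖ ^ 2 else 0)
    refine Finset.sum_congr rfl fun s _ => ?_
    simp only [Φ, hπ]
    split_ifs <;> simp
  have h2 : l2norm (Φ - Ψ) ≤ l2norm (Ψ ∘ π - Ψ) := by
    refine l2norm_le_of_norm_le fun s => ?_
    by_cases hs : c₁ s ∈ D
    · simp [Φ, hs]
    · have : Ψ s = 0 := by
        by_contra h
        exact hs (hsupp s h)
      simp [Φ, hs, this]
  have h3 := l2norm_sub_le Φ (Φ - Ψ)
  rw [sub_sub_cancel] at h3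
  linarith

end L2

/-! ### Symmetric projections and permutations acting on one factor. -/

section Symmetrizer

variable {X : Type*} [Fintype X] [DecidableEq X]

/-- The projection onto the vectors that are invariant under the involution `τ`. -/
def symProj (τ : Equiv.Perm X) : Matrix X X ℂ :=
  (2⁻¹ : ℂ) • (1 + (1 : Matrix X X ℂ).submatrix τ id)

lemma symProj_mulVec (τ : Equiv.Perm X) (Ψ : X → ℂ) (s : X) :
    (symProj τ *ᵥ Ψ) s = 2⁻¹ * (Ψ s + Ψ (τ s)) := by
  have : ((1 : Matrix X X ℂ).submatrix τ id *ᵥ Ψ) s = Ψ (τ s) := by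
    simp [Matrix.mulVec, dotProduct, Matrix.one_apply]
  rw [symProj, Matrix.smul_mulVec, Matrix.add_mulVec, Matrix.one_mulVec, Pi.smul_apply,
    Pi.add_apply, this, smul_eq_mul]

variable {τ : Equiv.Perm X} (hτ : Function.Involutive τ)

omit [Fintype X] in
include hτ in
lemma symProj_apply_perm (s s' : X) : symProj τ (τ s) s' = symProj τ s s' := by
  simp [symProj, Matrix.one_apply, hτ s, add_comm]

omit [Fintype X] in
include hτ in
lemma symProj_conjTranspose : (symProj τ)ᴴ = symProj τ := by
  ext s s'
  have h : τ s' = s ↔ τ s = s' := by rw [hτ.eq_iff, eq_comm]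
  simp only [symProj, Matrix.conjTranspose_apply, Matrix.smul_apply, Matrix.add_apply,
    Matrix.submatrix_apply, Matrix.one_apply, id, h, eq_comm (a := s') (b := s)]
  split_ifs <;> simp

include hτ in
lemma symProj_mul_self : symProj τ * symProj τ = symProj τ := by
  ext s s'
  have h := symProj_mulVec τ (fun t => symProj τ t s') s
  rw [symProj_apply_perm hτ] at h
  rw [Matrix.mul_apply]
  refine h.trans ?_
  ring

end Symmetrizer

lemma prod_update_smul_eq {V : Type*} [Fintype V] {f g : V → ℂ} {v : V} {c c' : ℂ}
    (hfg : ∀ u, u ≠ v → f u = g u) (h : c * f v = c' * g v) : c * ∏ u, f u = c' * ∏ u, g u := by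
  classical
  rw [← Finset.mul_prod_erase _ f (Finset.mem_univ v),
    ← Finset.mul_prod_erase _ g (Finset.mem_univ v), ← mul_assoc, ← mul_assoc, h,
    Finset.prod_congr rfl fun u hu => hfg u (Finset.ne_of_mem_erase hu)]

/-- The permutation of a product that acts on a single factor. -/
def factorPerm {X V : Type*} [DecidableEq V] {ι : V → Type*} (e : X ≃ ((v : V) → ι v)) (v : V)
    (τ : Equiv.Perm (ι v)) : Equiv.Perm X where
  toFun s := e.symm (Function.update (e s) v (τ (e s v)))
  invFun s := e.symm (Function.update (e s) v (τ.symm (e s v)))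
  left_inv s := by simp
  right_inv s := by simp

lemma factorPerm_apply {X V : Type*} [DecidableEq V] {ι : V → Type*} (e : X ≃ ((v : V) → ι v))
    (v : V) (τ : Equiv.Perm (ι v)) (s : X) :
    e (factorPerm e v τ s) = Function.update (e s) v (τ (e s v)) :=
  e.apply_symm_apply _

namespace DQMAProtocol

variable {V : Type*} [Fintype V] [DecidableEq V] {G : SimpleGraph V} {I : Type*}

/-- A linear relation between two rows of one local operation survives in the global state for every
certificate. Symmetry, product form and support of the state are all obtained this way. -/
lemma globalPrep_mulVec_relation (P : DQMAProtocol G I) (inp : V → I) (φ : P.Certs → ℂ) (v : V)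
    {s s' : P.Config} {c c' : ℂ} (hs : ∀ u, u ≠ v → P.outEquiv s u = P.outEquiv s' u)
    (h : ∀ z, c * P.prep v (inp v) (P.outEquiv s v) z =
      c' * P.prep v (inp v) (P.outEquiv s' v) z) :
    c * (P.globalPrep inp *ᵥ φ) s = c' * (P.globalPrep inp *ᵥ φ) s' := by
  simp only [Matrix.mulVec, dotProduct, Finset.mul_sum, ← mul_assoc]
  refine Finset.sum_congr rfl fun z _ => congrArg (· * φ z) ?_
  exact prod_update_smul_eq (f := fun u => P.prep u (inp u) (P.outEquiv s u) (z u))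
    (g := fun u => P.prep u (inp u) (P.outEquiv s' u) (z u)) (v := v)
    (fun u hu => by rw [hs u hu]) (h (z v))

lemma globalAccept_factorPerm (P : DQMAProtocol G I) (inp : V → I) (v : V)
    (τ : Equiv.Perm (P.In v))
    (h : ∀ x x', P.accept v (inp v) (τ x) x' = P.accept v (inp v) x x') (s s' : P.Config) :
    P.globalAccept inp (factorPerm P.inEquiv v τ s) s' = P.globalAccept inp s s' := by
  simp only [globalAccept_eq, Matrix.submatrix_apply, piKron_apply, factorPerm_apply]
  refine Finset.prod_congr rfl fun u _ => ?_
  by_cases hu : u = v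
  · subst hu
    rw [Function.update_self, h]
  · rw [Function.update_of_ne hu]

lemma globalAccept_conjTranspose (P : DQMAProtocol G I) (inp : V → I)
    (h : ∀ v, (P.accept v (inp v))ᴴ = P.accept v (inp v)) :
    (P.globalAccept inp)ᴴ = P.globalAccept inp := by
  rw [globalAccept_eq, Matrix.conjTranspose_submatrix, piKron_conjTranspose]
  simp only [h]

lemma globalAccept_mul_self (P : DQMAProtocol G I) (inp : V → I)
    (h : ∀ v, P.accept v (inp v) * P.accept v (inp v) = P.accept v (inp v)) :
    P.globalAccept inp * P.globalAccept inp = P.globalAccept inp := by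
  rw [globalAccept_eq, Matrix.submatrix_mul_equiv, piKron_mul]
  simp only [h]

/-- Completeness criterion for product certificates: `h2` says that the prepared state is also a
product when the registers are regrouped by receiver. -/
lemma acceptOp_mulVec_piVec (P : DQMAProtocol G I) (inp : V → I)
    (φ : ∀ v, QReg (P.certSize v) → ℂ) (χ : ∀ v, P.Out v → ℂ) (ω : ∀ v, P.In v → ℂ)
    (h1 : ∀ v, P.prep v (inp v) *ᵥ φ v = χ v)
    (h2 : ∀ s : P.Config, ∏ v, χ v (P.outEquiv s v) = ∏ v, ω v (P.inEquiv s v))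
    (h3 : ∀ v, P.accept v (inp v) *ᵥ ω v = ω v) :
    P.acceptOp inp *ᵥ piVec φ = piVec φ := by
  have hV : P.globalPrep inp *ᵥ piVec φ = piVec ω ∘ P.inEquiv := by
    rw [globalPrep_eq, Matrix.submatrix_mulVec_equiv]
    simp only [Equiv.refl_symm, Equiv.coe_refl, Function.comp_id, piKron_mulVec_piVec, h1]
    exact funext h2
  have hG : P.globalAccept inp *ᵥ (piVec ω ∘ P.inEquiv) = piVec ω ∘ P.inEquiv := by
    rw [globalAccept_eq, Matrix.submatrix_mulVec_equiv, Function.comp_assoc,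
      Equiv.self_comp_symm, Function.comp_id, piKron_mulVec_piVec]
    simp only [h3]
  rw [acceptOp, ← Matrix.mulVec_mulVec, ← Matrix.mulVec_mulVec, hV, hG, ← hV,
    Matrix.mulVec_mulVec, P.globalPrep_isometry, Matrix.one_mulVec]

lemma star_dotProduct_acceptOp (P : DQMAProtocol G I) (inp : V → I) (φ : P.Certs → ℂ) :
    star φ ⬝ᵥ (P.acceptOp inp *ᵥ φ) = star (P.globalPrep inp *ᵥ φ) ⬝ᵥ
      (P.globalAccept inp *ᵥ (P.globalPrep inp *ᵥ φ)) := by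
  rw [acceptOp, ← Matrix.mulVec_mulVec, ← Matrix.mulVec_mulVec, Matrix.star_mulVec,
    ← Matrix.dotProduct_mulVec]

end DQMAProtocol

/-! ### Measurements recorded in a flag. -/

section Measurement

variable {ι : Type*} [Fintype ι] [DecidableEq ι]

/-- The isometry that measures the projection `E` and records the outcome in a flag. -/
def flagIso (E : Matrix ι ι ℂ) : Matrix (Bool × ι) ι ℂ :=
  Matrix.of fun s z => if s.1 then E s.2 z else (1 - E) s.2 z

lemma flagIso_isometry {E : Matrix ι ι ℂ} (h1 : Eᴴ = E) (h2 : E * E = E) :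
    (flagIso E)ᴴ * flagIso E = 1 := by
  have h : (flagIso E)ᴴ * flagIso E = Eᴴ * E + (1 - E)ᴴ * (1 - E) := by
    ext z z'
    rw [Matrix.add_apply, Matrix.mul_apply, Fintype.sum_prod_type, Fintype.sum_bool,
      Matrix.mul_apply, Matrix.mul_apply]
    rfl
  rw [h, Matrix.conjTranspose_sub, Matrix.conjTranspose_one, h1, sub_mul, mul_sub, mul_sub, h2,
    one_mul, mul_one, one_mul, sub_self, sub_zero, add_sub_cancel]

lemma flagIso_mulVec {E : Matrix ι ι ℂ} {x : ι → ℂ} (h : E *ᵥ x = x) (s : Bool × ι) :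
    (flagIso E *ᵥ x) s = if s.1 then x s.2 else 0 := by
  have h' : (1 - E) *ᵥ x = 0 := by rw [Matrix.sub_mulVec, Matrix.one_mulVec, h, sub_self]
  obtain ⟨b, i⟩ := s
  cases b
  · simpa [flagIso, Matrix.mulVec] using congrFun h' i
  · simpa [flagIso, Matrix.mulVec] using congrFun h i

/-- The projection onto the vectors invariant under `τ` and supported on `p`. -/
def flaggedSymProj (p : ι → Bool) (τ : Equiv.Perm ι) : Matrix ι ι ℂ :=
  Matrix.diagonal (fun s => if p s then 1 else 0) * symProj τ

variable {p : ι → Bool} {τ : Equiv.Perm ι}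

lemma flaggedSymProj_apply (s s' : ι) :
    flaggedSymProj p τ s s' = if p s then symProj τ s s' else 0 := by
  rw [flaggedSymProj, Matrix.diagonal_mul]
  split_ifs <;> simp

lemma flaggedSymProj_mulVec {x : ι → ℂ} (h1 : ∀ s, x (τ s) = x s)
    (h2 : ∀ s, p s = false → x s = 0) : flaggedSymProj p τ *ᵥ x = x := by
  ext s
  rw [flaggedSymProj, ← Matrix.mulVec_mulVec, Matrix.mulVec_diagonal, symProj_mulVec, h1]
  cases h : p s
  · simp [h2 s h]
  · simp only [if_true]
    ring

variable (hτ : Function.Involutive τ) (hp : ∀ s, p (τ s) = p s)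

include hτ hp in
lemma flaggedSymProj_apply_perm (s s' : ι) :
    flaggedSymProj p τ (τ s) s' = flaggedSymProj p τ s s' := by
  rw [flaggedSymProj_apply, flaggedSymProj_apply, hp, symProj_apply_perm hτ]

include hp in
lemma diagonal_mul_symProj_comm :
    Matrix.diagonal (fun s => if p s then (1 : ℂ) else 0) * symProj τ =
      symProj τ * Matrix.diagonal (fun s => if p s then (1 : ℂ) else 0) := by
  ext s s'
  rw [Matrix.diagonal_mul, Matrix.mul_diagonal, mul_comm]
  simp only [symProj, Matrix.smul_apply, Matrix.add_apply, Matrix.submatrix_apply,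
    Matrix.one_apply, id]
  by_cases h1 : s = s'
  · rw [h1]
  · by_cases h2 : τ s = s'
    · rw [← h2, hp]
    · simp [h1, h2]

-- The flag projection commutes with the symmetrizer, so unflagged columns vanish as well as
-- unflagged rows.
include hp in
lemma flaggedSymProj_eq_zero {s s' : ι} (h : p s' = false) : flaggedSymProj p τ s s' = 0 := by
  rw [flaggedSymProj, diagonal_mul_symProj_comm hp, Matrix.mul_diagonal, h]
  simp

include hτ hp in
lemma flaggedSymProj_conjTranspose : (flaggedSymProj p τ)ᴴ = flaggedSymProj p τ := by
  rw [flaggedSymProj, Matrix.conjTranspose_mul, symProj_conjTranspose hτ,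
    Matrix.diagonal_conjTranspose, diagonal_mul_symProj_comm hp]
  congr 2
  ext s
  simp only [Pi.star_apply]
  split_ifs <;> simp

include hτ hp in
lemma flaggedSymProj_mul_self :
    flaggedSymProj p τ * flaggedSymProj p τ = flaggedSymProj p τ := by
  have hd : Matrix.diagonal (fun s => if p s then (1 : ℂ) else 0) *
      Matrix.diagonal (fun s => if p s then (1 : ℂ) else 0) =
      Matrix.diagonal (fun s => if p s then (1 : ℂ) else 0) := by
    rw [Matrix.diagonal_mul_diagonal]
    congr 1
    ext s
    split_ifs <;> simp
  rw [flaggedSymProj, diagonal_mul_symProj_comm hp, Matrix.mul_assoc,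
    ← Matrix.mul_assoc (Matrix.diagonal _), diagonal_mul_symProj_comm hp, Matrix.mul_assoc, hd,
    ← Matrix.mul_assoc, symProj_mul_self hτ]

end Measurement

/-! ### Registers and wiring of the path protocol. -/

/-- Truncate a register, or pad it with zeros. -/
def resize {k l : ℕ} (t : QReg k) : QReg l := fun j => if h : (j : ℕ) < k then t ⟨j, h⟩ else false

/-- Message lengths equal `m` only propositionally; `resize` replaces casts and is inverted by this
identity. -/
lemma resize_resize {k l : ℕ} (hkl : k ≤ l) (t : QReg k) : resize (resize t : QReg l) = t := by
  funext j
  simp [resize, j.2.trans_le hkl]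

/-- A register of `2 * m` qubits consists of two registers of `m` qubits. -/
def pairEquiv (m : ℕ) : QReg (2 * m) ≃ QReg m × QReg m :=
  (regEquiv 2 m).trans (finTwoArrowEquiv _)

namespace PathProtocol

variable {r : ℕ}

/-- The node to which a node of the path sends its message: its right neighbour, or its left
neighbour if it is the right end. -/
def next (u : Fin (r + 1)) : Fin (r + 1) :=
  -- The right end sends a register only to make all nodes uniform; no swap test reads it.
  if h : (u : ℕ) < r then ⟨u + 1, by omega⟩ else ⟨r - 1, by omega⟩

/-- The left neighbour of a node of the path. -/
def prev (v : Fin (r + 1)) : Fin (r + 1) := ⟨v - 1, by omega⟩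

lemma next_prev {v : Fin (r + 1)} (hv : v ≠ 0) : next (prev v) = v := by
  have h0 : (v : ℕ) ≠ 0 := fun h => hv (Fin.ext h)
  have h1 : (v : ℕ) - 1 < r := by omega
  have h2 : next (prev v) = ⟨(v : ℕ) - 1 + 1, by omega⟩ := dif_pos h1
  rw [h2]
  exact Fin.ext (Nat.succ_pred h0)

lemma adj_next (hr : 1 ≤ r) (u : Fin (r + 1)) : (SimpleGraph.pathGraph (r + 1)).Adj u (next u) := by
  rw [SimpleGraph.pathGraph_adj]
  unfold next
  split_ifs with h
  · exact Or.inl rfl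
  · right
    have := u.2
    simp only
    omega

/-- Every node of the path sends `m` qubits to a single neighbour. -/
def msgSize (m : ℕ) (u v : Fin (r + 1)) : ℕ := if v = next u then m else 0

lemma msgSize_le (m : ℕ) (u v : Fin (r + 1)) : msgSize m u v ≤ m := by
  unfold msgSize
  split_ifs <;> omega

lemma msgSize_next (m : ℕ) (u : Fin (r + 1)) : msgSize m u (next u) = m := if_pos rfl

lemma msgSize_prev (m : ℕ) {v : Fin (r + 1)} (hv : v ≠ 0) : msgSize m (prev v) v = m :=
  if_pos (next_prev hv).symm

/-- The messages sent by a node amount to a single register of `m` qubits. -/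
def sentEquiv (m : ℕ) (u : Fin (r + 1)) : ((w : Fin (r + 1)) → QReg (msgSize m u w)) ≃ QReg m where
  toFun t := resize (t (next u))
  invFun a _ := resize a
  left_inv t := by
    funext w
    by_cases h : w = next u
    · subst h
      exact resize_resize (msgSize_le m u _) _
    · funext j
      have h0 : msgSize m u w = 0 := if_neg h
      exact absurd j.2 (by omega)
  right_inv a := resize_resize (msgSize_next m u).ge a

/-- The registers of a node before the communication: a flag, a register that is kept and a
register that is sent. -/
def outNodeEquiv (m : ℕ) (v : Fin (r + 1)) :
    ((Bool × QReg m) × ((w : Fin (r + 1)) → QReg (msgSize m v w))) ≃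
      Bool × (QReg m × QReg m) :=
  (Equiv.prodCongr (Equiv.refl _) (sentEquiv m v)).trans (Equiv.prodAssoc _ _ _)

/-- Exchange the register kept by a node and the message from its left neighbour. -/
def swapInFun (m : ℕ) (v : Fin (r + 1))
    (s : (Bool × QReg m) × ((u : Fin (r + 1)) → QReg (msgSize m u v))) :
    (Bool × QReg m) × ((u : Fin (r + 1)) → QReg (msgSize m u v)) :=
  if v = 0 then s else
    ((s.1.1, resize (s.2 (prev v))), Function.update s.2 (prev v) (resize s.1.2))

lemma swapInFun_involutive (m : ℕ) (v : Fin (r + 1)) : Function.Involutive (swapInFun m v) := by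
  intro s
  by_cases hv : v = 0
  · simp [swapInFun, hv]
  · simp only [swapInFun, if_neg hv, Function.update_self, Function.update_idem]
    rw [resize_resize (msgSize_prev m hv).ge, resize_resize (msgSize_le m _ _),
      Function.update_eq_self]

/-- Exchange the register kept by a node and the message from its left neighbour. -/
def swapIn (m : ℕ) (v : Fin (r + 1)) :
    Equiv.Perm ((Bool × QReg m) × ((u : Fin (r + 1)) → QReg (msgSize m u v))) :=
  (swapInFun_involutive m v).toPerm

lemma swapIn_involutive (m : ℕ) (v : Fin (r + 1)) : Function.Involutive (swapIn m v) :=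
  swapInFun_involutive m v

lemma swapIn_apply (m : ℕ) {v : Fin (r + 1)} (hv : v ≠ 0)
    (s : (Bool × QReg m) × ((u : Fin (r + 1)) → QReg (msgSize m u v))) :
    swapIn m v s =
      ((s.1.1, resize (s.2 (prev v))), Function.update s.2 (prev v) (resize s.1.2)) :=
  if_neg hv

lemma swapIn_flag (m : ℕ) (v : Fin (r + 1))
    (s : (Bool × QReg m) × ((u : Fin (r + 1)) → QReg (msgSize m u v))) :
    (swapIn m v s).1.1 = s.1.1 := by
  change (swapInFun m v s).1.1 = s.1.1
  unfold swapInFun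
  split_ifs <;> rfl

/-- The accepting projection of a node: the flag is set, and the register kept and the message from
the left neighbour are in the symmetric subspace. -/
def acceptProj (m : ℕ) (v : Fin (r + 1)) :
    Matrix ((Bool × QReg m) × ((u : Fin (r + 1)) → QReg (msgSize m u v)))
      ((Bool × QReg m) × ((u : Fin (r + 1)) → QReg (msgSize m u v))) ℂ :=
  flaggedSymProj (fun s => s.1.1) (swapIn m v)

lemma acceptProj_conjTranspose (m : ℕ) (v : Fin (r + 1)) : (acceptProj m v)ᴴ = acceptProj m v :=
  flaggedSymProj_conjTranspose (swapIn_involutive m v) (swapIn_flag m v)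

lemma acceptProj_mul_self (m : ℕ) (v : Fin (r + 1)) :
    acceptProj m v * acceptProj m v = acceptProj m v :=
  flaggedSymProj_mul_self (swapIn_involutive m v) (swapIn_flag m v)

variable {n m : ℕ}

/-- The projection onto the state `ψ` of the second register. -/
def startProj (ψ : QReg m → ℂ) : Matrix (QReg m × QReg m) (QReg m × QReg m) ℂ :=
  Matrix.of fun s s' => if s.1 = s'.1 then ψ s.2 * star (ψ s'.2) else 0

/-- The projection onto the basis states of the first register in `D`. -/
def finishProj (D : Finset (QReg m)) : Matrix (QReg m × QReg m) (QReg m × QReg m) ℂ :=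
  Matrix.diagonal fun s => if s.1 ∈ D then 1 else 0

/-- The projection measured by a node on the two registers of its certificate: the left end checks
that the second register is its fingerprint, the right end measures the first register in the
computational basis, and the others check the symmetry of their registers. -/
def nodeProj (ψ : BitString n → QReg m → ℂ) (D : BitString n → Finset (QReg m)) (v : Fin (r + 1)) :
    Option (BitString n) → Matrix (QReg m × QReg m) (QReg m × QReg m) ℂ
  | none => symProj (Equiv.prodComm _ _)
  | some x => if v = 0 then startProj (ψ x) else finishProj (D x)

lemma prodComm_involutive {α : Type*} : Function.Involutive (Equiv.prodComm α α) := fun _ => rfl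

lemma startProj_conjTranspose (ψ : QReg m → ℂ) : (startProj ψ)ᴴ = startProj ψ := by
  ext s s'
  simp only [startProj, Matrix.conjTranspose_apply, Matrix.of_apply, eq_comm (a := s'.1)]
  split_ifs
  · rw [star_mul', star_star, mul_comm]
  · exact star_zero _

lemma sum_star_mul_self {ψ : QReg m → ℂ} (hψ : ∑ a, ‖ψ a‖ ^ 2 = 1) :
    ∑ a, star (ψ a) * ψ a = 1 := by
  have : ∀ a, star (ψ a) * ψ a = ((‖ψ a‖ ^ 2 : ℝ) : ℂ) := fun a => by
    rw [Complex.star_def, Complex.conj_mul']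
    push_cast
    rfl
  simp only [this]
  rw [← Complex.ofReal_sum, hψ, Complex.ofReal_one]

lemma startProj_mul_self {ψ : QReg m → ℂ} (hψ : ∑ a, ‖ψ a‖ ^ 2 = 1) :
    startProj ψ * startProj ψ = startProj ψ := by
  ext s s'
  rw [Matrix.mul_apply, Fintype.sum_prod_type, Finset.sum_eq_single s.1]
  · simp only [startProj, Matrix.of_apply, if_true]
    split_ifs
    · calc ∑ b, ψ s.2 * star (ψ b) * (ψ b * star (ψ s'.2))
          = ∑ b, ψ s.2 * star (ψ s'.2) * (star (ψ b) * ψ b) :=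
            Finset.sum_congr rfl fun b _ => by ring
        _ = _ := by rw [← Finset.mul_sum, sum_star_mul_self hψ, mul_one]
    · simp
  · intro a _ ha
    exact Finset.sum_eq_zero fun b _ => by simp [startProj, ha.symm]
  · simp

lemma finishProj_conjTranspose (D : Finset (QReg m)) : (finishProj D)ᴴ = finishProj D := by
  rw [finishProj, Matrix.diagonal_conjTranspose]
  congr 1
  ext s
  simp only [Pi.star_apply]
  split_ifs <;> simp

lemma finishProj_mul_self (D : Finset (QReg m)) : finishProj D * finishProj D = finishProj D := by
  rw [finishProj, Matrix.diagonal_mul_diagonal]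
  congr 1
  ext s
  split_ifs <;> simp

variable {ψ : BitString n → QReg m → ℂ} (hψ : ∀ x, ∑ a, ‖ψ x a‖ ^ 2 = 1)
  (D : BitString n → Finset (QReg m))

lemma nodeProj_conjTranspose (ψ : BitString n → QReg m → ℂ) (v : Fin (r + 1))
    (i : Option (BitString n)) : (nodeProj ψ D v i)ᴴ = nodeProj ψ D v i := by
  cases i with
  | none => exact symProj_conjTranspose prodComm_involutive
  | some x =>
    simp only [nodeProj]
    split_ifs
    exacts [startProj_conjTranspose _, finishProj_conjTranspose _]

include hψ in
lemma nodeProj_mul_self (v : Fin (r + 1)) (i : Option (BitString n)) :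
    nodeProj ψ D v i * nodeProj ψ D v i = nodeProj ψ D v i := by
  cases i with
  | none => exact symProj_mul_self prodComm_involutive
  | some x =>
    simp only [nodeProj]
    split_ifs
    exacts [startProj_mul_self (hψ x), finishProj_mul_self _]

/-- One round of the path protocol. -/
def oneRound (hr : 1 ≤ r) :
    DQMAProtocol (SimpleGraph.pathGraph (r + 1)) (Option (BitString n)) where
  certSize _ := 2 * m
  msgSize := msgSize m
  msgSize_eq_zero u v h := if_neg fun huv => h (by rw [huv]; exact adj_next hr u)
  Mem _ := Bool × QReg m
  prep v i := (flagIso (nodeProj ψ D v i)).submatrix (outNodeEquiv m v) (pairEquiv m)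
  prep_isometry v i := by
    rw [Matrix.conjTranspose_submatrix, Matrix.submatrix_mul_equiv,
      flagIso_isometry (nodeProj_conjTranspose D ψ v i) (nodeProj_mul_self hψ D v i),
      Matrix.submatrix_one_equiv]
  accept v _ := acceptProj m v
  accept_isEffect v _ :=
    isEffect_of_isHermitian_of_mul_self (acceptProj_conjTranspose m v) (acceptProj_mul_self m v)

lemma pathInput_zero (x y : BitString n) : pathInput (r := r) x y 0 = some x := if_pos rfl

lemma pathInput_last (hr : 1 ≤ r) (x y : BitString n) :
    pathInput x y (Fin.last r) = some y := by
  have : Fin.last r ≠ 0 := fun h => by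
    have := congrArg Fin.val h
    simp at this
    omega
  simp [pathInput, this]

lemma pathInput_of_ne (x y : BitString n) {v : Fin (r + 1)} (h0 : v ≠ 0) (hl : v ≠ Fin.last r) :
    pathInput x y v = none := by
  simp [pathInput, h0, hl]

end PathProtocol

/-! ### Completeness of one round. -/

namespace PathProtocol

variable {n m r : ℕ} {ψ : BitString n → QReg m → ℂ} (hψ : ∀ x, ∑ a, ‖ψ x a‖ ^ 2 = 1)
  (D : BitString n → Finset (QReg m)) (hr : 1 ≤ r)

lemma startProj_mulVec {ξ : QReg m → ℂ} (hξ : ∑ a, ‖ξ a‖ ^ 2 = 1) (η : QReg m → ℂ) :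
    (startProj ξ *ᵥ fun q => η q.1 * ξ q.2) = fun q => η q.1 * ξ q.2 := by
  ext s
  rw [Matrix.mulVec, dotProduct, Fintype.sum_prod_type, Finset.sum_eq_single s.1]
  · calc ∑ b, startProj ξ s (s.1, b) * (η s.1 * ξ b)
        = ∑ b, η s.1 * ξ s.2 * (star (ξ b) * ξ b) :=
          Finset.sum_congr rfl fun b _ => by simp only [startProj, Matrix.of_apply, if_true]; ring
      _ = _ := by rw [← Finset.mul_sum, sum_star_mul_self hξ, mul_one]
  · intro a _ ha
    exact Finset.sum_eq_zero fun b _ => by simp [startProj, ha.symm]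
  · simp

lemma finishProj_mulVec {ξ : QReg m → ℂ} {S : Finset (QReg m)} (hS : ∀ a, ξ a ≠ 0 → a ∈ S)
    (η : QReg m → ℂ) :
    (finishProj S *ᵥ fun q => ξ q.1 * η q.2) = fun q => ξ q.1 * η q.2 := by
  ext s
  rw [finishProj, Matrix.mulVec_diagonal]
  by_cases h : s.1 ∈ S
  · simp [h]
  · have : ξ s.1 = 0 := by
      by_contra h0
      exact h (hS _ h0)
    simp [this]

lemma nodeProj_mulVec (hr : 1 ≤ r) {x y : BitString n} (hψx : ∑ a, ‖ψ x a‖ ^ 2 = 1)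
    (hxy : ∀ a, ψ x a ≠ 0 → a ∈ D y) (v : Fin (r + 1)) :
    (nodeProj ψ D v (pathInput x y v) *ᵥ fun q => ψ x q.1 * ψ x q.2) =
      fun q => ψ x q.1 * ψ x q.2 := by
  by_cases h0 : v = 0
  · subst h0
    rw [pathInput_zero]
    exact startProj_mulVec hψx _
  by_cases hl : v = Fin.last r
  · subst hl
    rw [pathInput_last hr]
    simp only [nodeProj, if_neg h0]
    exact finishProj_mulVec hxy _
  · rw [pathInput_of_ne x y h0 hl]
    ext s
    rw [nodeProj, symProj_mulVec]
    simp only [Equiv.prodComm_apply, Prod.fst_swap, Prod.snd_swap]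
    ring

/-- The honest vector at a node after the communication. -/
def honestIn (ξ : QReg m → ℂ) (v : Fin (r + 1))
    (s : (Bool × QReg m) × ((u : Fin (r + 1)) → QReg (msgSize m u v))) : ℂ :=
  (if s.1.1 then ξ s.1.2 else 0) * ∏ u, if v = next u then ξ (resize (s.2 u)) else 1

lemma honestIn_swapIn (ξ : QReg m → ℂ) (v : Fin (r + 1))
    (s : (Bool × QReg m) × ((u : Fin (r + 1)) → QReg (msgSize m u v))) :
    honestIn ξ v (swapIn m v s) = honestIn ξ v s := by
  by_cases hv : v = 0
  · have : swapIn m v s = s := if_pos hv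
    rw [this]
  · rw [swapIn_apply m hv]
    simp only [honestIn]
    rw [← Finset.mul_prod_erase _ _ (Finset.mem_univ (prev v)),
      ← Finset.mul_prod_erase Finset.univ (fun u => if v = next u then ξ (resize (s.2 u)) else 1)
        (Finset.mem_univ (prev v))]
    have h : ∀ u ∈ Finset.univ.erase (prev v), (if v = next u then
        ξ (resize (Function.update s.2 (prev v) (resize s.1.2) u)) else 1) =
        if v = next u then ξ (resize (s.2 u)) else 1 := fun u hu => by
      rw [Function.update_of_ne (Finset.ne_of_mem_erase hu)]
    rw [Finset.prod_congr rfl h, Function.update_self, resize_resize (msgSize_prev m hv).ge,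
      if_pos (next_prev hv).symm, if_pos (next_prev hv).symm]
    split_ifs <;> ring

/-- Two copies of `ψ x` at every node pass all local checks, and the state remains a product of
copies of `ψ x` after the communication, so every swap test passes too. -/
lemma oneRound_complete {x y : BitString n} (hxy : ∀ a, ψ x a ≠ 0 → a ∈ D y) :
    ∃ φ : (oneRound hψ D hr).Certs → ℂ, star φ ⬝ᵥ φ = 1 ∧
      (oneRound hψ D hr).acceptOp (pathInput x y) *ᵥ φ = φ := by
  let ξ := ψ x
  let pair : QReg m × QReg m → ℂ := fun q => ξ q.1 * ξ q.2
  have hpair : star pair ⬝ᵥ pair = 1 := by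
    have h := sum_star_mul_self (hψ x)
    calc star pair ⬝ᵥ pair = ∑ a, ∑ b, (star (ξ a) * ξ a) * (star (ξ b) * ξ b) := by
          rw [dotProduct, Fintype.sum_prod_type]
          refine Finset.sum_congr rfl fun a _ => Finset.sum_congr rfl fun b _ => ?_
          simp only [pair, Pi.star_apply, star_mul']
          ring
      _ = 1 := by simp only [← Finset.mul_sum, ξ, h, mul_one]
  let φ : Fin (r + 1) → QReg (2 * m) → ℂ := fun _ => pair ∘ pairEquiv m
  refine ⟨piVec φ, ?_, ?_⟩
  · have h : star (piVec φ) ⬝ᵥ piVec φ = 1 := by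
      rw [star_piVec, piVec_dotProduct_piVec]
      refine Finset.prod_eq_one fun v _ => ?_
      rw [← hpair]
      exact Fintype.sum_equiv (pairEquiv m) _ _ fun _ => rfl
    exact h
  · let χ : ∀ v : Fin (r + 1),
        (Bool × QReg m) × ((w : Fin (r + 1)) → QReg (msgSize m v w)) → ℂ := fun v s =>
      if s.1.1 then ξ s.1.2 * ξ (resize (s.2 (next v))) else 0
    refine (oneRound hψ D hr).acceptOp_mulVec_piVec _ φ χ (honestIn ξ) (fun v => ?_)
      (fun s => ?_) fun v => ?_
    · change (flagIso (nodeProj ψ D v (pathInput x y v))).submatrix (outNodeEquiv m v)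
        (pairEquiv m) *ᵥ (pair ∘ pairEquiv m) = χ v
      rw [Matrix.submatrix_mulVec_equiv, Function.comp_assoc, Equiv.self_comp_symm,
        Function.comp_id]
      funext s
      exact flagIso_mulVec (nodeProj_mulVec D hr (hψ x) hxy v) _
    · calc ∏ v, (if (s.1 v).1 then ξ (s.1 v).2 * ξ (resize (s.2 v (next v))) else 0)
          = (∏ v, if (s.1 v).1 then ξ (s.1 v).2 else 0) *
            ∏ u, ξ (resize (s.2 u (next u))) := by
            rw [← Finset.prod_mul_distrib]
            exact Finset.prod_congr rfl fun v _ => by split_ifs <;> simp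
        _ = (∏ v, if (s.1 v).1 then ξ (s.1 v).2 else 0) *
            ∏ u, ∏ v, if v = next u then ξ (resize (s.2 u v)) else 1 := by
            congr 1
            refine Finset.prod_congr rfl fun u _ => ?_
            rw [Finset.prod_ite_eq' Finset.univ (next u) fun v => ξ (resize (s.2 u v)),
              if_pos (Finset.mem_univ _)]
        _ = _ := by
            rw [Finset.prod_comm, ← Finset.prod_mul_distrib]
            rfl
    · exact flaggedSymProj_mulVec (honestIn_swapIn ξ v) fun s hs => by simp [honestIn, hs]

end PathProtocol

/-! ### Soundness of one round. -/

/-- The component `G *ᵥ Ψ` is fixed by `T`, so only the remainder `Ψ - G *ᵥ Ψ` moves, by at most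
twice its norm. -/
lemma l2norm_comp_sub_le {X : Type*} [Fintype X] {G : Matrix X X ℂ} (T : Equiv.Perm X)
    (hT : ∀ s s', G (T s) s' = G s s') (Ψ : X → ℂ) :
    l2norm (Ψ ∘ T - Ψ) ≤ 2 * l2norm (Ψ - G *ᵥ Ψ) := by
  have h : Ψ ∘ T - Ψ = (Ψ - G *ᵥ Ψ) ∘ T - (Ψ - G *ᵥ Ψ) := by
    funext s
    have : (G *ᵥ Ψ) (T s) = (G *ᵥ Ψ) s := by simp only [Matrix.mulVec, dotProduct, hT]
    simp [this]
  rw [h]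
  refine (l2norm_sub_le _ _).trans (le_of_eq ?_)
  rw [l2norm_comp_perm, two_mul]

/-- Registers `a v` and `b v` at the nodes `v` of a path: if `Ψ` is invariant under the exchange of
the registers of the inner nodes, `b 0` is in the state `ψ`, and `a r` is supported on a set of
small `ψ`-mass, then the projection `G` onto the states that are invariant under the exchange of
registers of neighbours shortens `Ψ`. -/
lemma l2norm_projection_sq_le_of_path {X α : Type*} [Fintype X] [Fintype α] [DecidableEq α] {r : ℕ}
    (hr : 1 ≤ r) {G : Matrix X X ℂ} (hG : Gᴴ = G) (hGG : G * G = G) {Ψ : X → ℂ}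
    {a b : Fin (r + 1) → X → α} {T : Fin r → Equiv.Perm X} {U : Fin (r + 1) → Equiv.Perm X}
    (hT : ∀ j s, b j.castSucc (T j s) = a j.succ s)
    (hGT : ∀ j s s', G (T j s) s' = G s s')
    (hU : ∀ v s, a v (U v s) = b v s)
    (hΨU : ∀ v, v ≠ 0 → v ≠ Fin.last r → ∀ s, Ψ (U v s) = Ψ s)
    {ψ : α → ℂ} {D : Finset α} {put : X → α → X}
    (hput : ∀ s c, b 0 (put s c) = c) (hput' : ∀ s c, put (put s c) (b 0 s) = s)
    (hfac : ∀ s c c', ψ c' * Ψ (put s c) = ψ c * Ψ (put s c'))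
    (hψ : ∑ c, ‖ψ c‖ ^ 2 = 1) (hD : ∑ c ∈ D, ‖ψ c‖ ^ 2 ≤ 1 / 4)
    (hsupp : ∀ s, Ψ s ≠ 0 → a (Fin.last r) s ∈ D) :
    l2norm (G *ᵥ Ψ) ^ 2 ≤ (1 - 1 / (16 * (r : ℝ) ^ 2)) * l2norm Ψ ^ 2 := by
  set η := l2norm (Ψ - G *ᵥ Ψ) with hη
  -- Going one node further composes with the exchange inside the node, which is free, and the
  -- exchange across the next edge, which costs `2η`.
  have hmove : ∀ v : Fin (r + 1), v ≠ 0 → ∃ π : Equiv.Perm X, (∀ s, b 0 (π s) = a v s) ∧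
      l2norm (Ψ ∘ π - Ψ) ≤ 2 * (v : ℕ) * η := by
    intro v
    induction v using Fin.induction with
    | zero => exact fun h => absurd rfl h
    | succ j ih =>
      intro _
      have hTj := l2norm_comp_sub_le (T j) (hGT j) Ψ
      by_cases h0 : j.castSucc = 0
      · have hj : (j : ℕ) = 0 := congrArg Fin.val h0
        refine ⟨T j, fun s => by rw [← h0, hT], hTj.trans (le_of_eq ?_)⟩
        simp [hj, hη]
      · obtain ⟨π, hπ, hle⟩ := ih h0
        have hlast : j.castSucc ≠ Fin.last r := (Fin.castSucc_lt_last j).ne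
        refine ⟨(T j).trans ((U j.castSucc).trans π), fun s => ?_, ?_⟩
        · simp [hπ, hU, hT]
        · have h1 : Ψ ∘ ((T j).trans ((U j.castSucc).trans π)) - Ψ =
              (Ψ ∘ π - Ψ) ∘ ((T j).trans (U j.castSucc)) + (Ψ ∘ T j - Ψ) := by
            funext s
            simp [hΨU _ h0 hlast]
          rw [h1]
          refine (l2norm_add_le _ _).trans ?_
          rw [l2norm_comp_perm]
          refine (add_le_add hle hTj).trans (le_of_eq ?_)
          rw [← hη, Fin.val_succ, Fin.val_castSucc]
          push_cast
          ring
  have hr' : (1 : ℝ) ≤ r := by exact_mod_cast hr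
  obtain ⟨π, hπ, hle⟩ := hmove (Fin.last r) fun h => by
    have := congrArg Fin.val h
    simp at this
    omega
  have h1 := l2norm_le_two_mul_of_moved hput hput' hfac hψ hD hsupp hπ
  rw [Fin.val_last] at hle
  -- The moved state differs from `Ψ` by at least `‖Ψ‖ / 2` and by at most `2rη`.
  have h2 : l2norm Ψ ≤ 4 * r * η := by linarith
  have h3 : l2norm Ψ ^ 2 ≤ 16 * (r : ℝ) ^ 2 * (l2norm Ψ ^ 2 - l2norm (G *ᵥ Ψ) ^ 2) := by
    rw [← l2norm_sub_projection_sq hG hGG]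
    calc l2norm Ψ ^ 2 ≤ (4 * r * η) ^ 2 := pow_le_pow_left₀ (l2norm_nonneg _) h2 2
      _ = _ := by ring
  have h4 : (0 : ℝ) < 16 * (r : ℝ) ^ 2 := by positivity
  have h5 : l2norm Ψ ^ 2 / (16 * (r : ℝ) ^ 2) ≤ l2norm Ψ ^ 2 - l2norm (G *ᵥ Ψ) ^ 2 := by
    rw [div_le_iff₀ h4]
    linarith
  have h6 : (1 - 1 / (16 * (r : ℝ) ^ 2)) * l2norm Ψ ^ 2 =
      l2norm Ψ ^ 2 - l2norm Ψ ^ 2 / (16 * (r : ℝ) ^ 2) := by ring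
  linarith

namespace PathProtocol

variable {n m r : ℕ}

lemma resize_swapIn (v : Fin (r + 1)) (hv : v ≠ 0)
    (s : (Bool × QReg m) × ((u : Fin (r + 1)) → QReg (msgSize m u v))) :
    (resize ((swapIn m v s).2 (prev v)) : QReg m) = s.1.2 := by
  rw [swapIn_apply m hv]
  change resize (Function.update s.2 (prev v) (resize s.1.2) (prev v)) = s.1.2
  rw [Function.update_self, resize_resize (msgSize_prev m hv).ge]

/-- Exchange the two registers of a node before the communication. -/
def swapOut (m : ℕ) (v : Fin (r + 1)) :
    Equiv.Perm ((Bool × QReg m) × ((w : Fin (r + 1)) → QReg (msgSize m v w))) :=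
  (outNodeEquiv m v).trans
    ((Equiv.prodCongr (Equiv.refl _) (Equiv.prodComm _ _)).trans (outNodeEquiv m v).symm)

variable {ψ : BitString n → QReg m → ℂ} (hψ : ∀ x, ∑ a, ‖ψ x a‖ ^ 2 = 1)
  (D : BitString n → Finset (QReg m)) (hr : 1 ≤ r)

/-- The register kept by a node. -/
def kept (v : Fin (r + 1)) (s : (oneRound hψ D hr).Config) : QReg m := (s.1 v).2

/-- The register sent by a node. -/
def sent (v : Fin (r + 1)) (s : (oneRound hψ D hr).Config) : QReg m :=
  resize (s.2 v (next v))

/-- Overwrite the register sent by the left end. -/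
def putSent (s : (oneRound hψ D hr).Config) (c : QReg m) : (oneRound hψ D hr).Config :=
  (s.1, Function.update s.2 0 fun _ => resize c)

lemma sent_putSent (s : (oneRound hψ D hr).Config) (c : QReg m) :
    sent hψ D hr 0 (putSent hψ D hr s c) = c := by
  change resize (Function.update s.2 0 (fun _ => resize c) 0 (next 0)) = c
  rw [Function.update_self]
  exact resize_resize (msgSize_next m 0).ge c

lemma putSent_putSent (s : (oneRound hψ D hr).Config) (c : QReg m) :
    putSent hψ D hr (putSent hψ D hr s c) (sent hψ D hr 0 s) = s := by
  refine Prod.ext rfl ?_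
  change Function.update (Function.update s.2 0 _) 0 _ = s.2
  rw [Function.update_idem]
  refine Function.update_eq_self_iff.mpr ?_
  exact (sentEquiv m 0).left_inv (s.2 0)

lemma sent_factorPerm_swapIn (j : Fin r) (s : (oneRound hψ D hr).Config) :
    sent hψ D hr j.castSucc
      (factorPerm (oneRound hψ D hr).inEquiv j.succ (swapIn m j.succ) s) =
      kept hψ D hr j.succ s := by
  have hj : prev j.succ = j.castSucc := Fin.ext (by simp [prev])
  have hnext : next j.castSucc = j.succ := by
    rw [← hj, next_prev (Fin.succ_ne_zero j)]
  have h := congrFun (factorPerm_apply (oneRound hψ D hr).inEquiv j.succ (swapIn m j.succ) s) j.succ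
  rw [Function.update_self] at h
  have h' := (congrArg (fun q => (resize (q.2 (prev j.succ)) : QReg m)) h).trans
    (resize_swapIn j.succ (Fin.succ_ne_zero j) ((oneRound hψ D hr).inEquiv s j.succ))
  rw [hj] at h'
  rw [sent, hnext]
  exact h'

lemma kept_factorPerm_swapOut (v : Fin (r + 1)) (s : (oneRound hψ D hr).Config) :
    kept hψ D hr v (factorPerm (oneRound hψ D hr).outEquiv v (swapOut m v) s) =
      sent hψ D hr v s := by
  have h := congrFun (factorPerm_apply (oneRound hψ D hr).outEquiv v (swapOut m v) s) v
  rw [Function.update_self] at h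
  exact congrArg (fun q => q.1.2) h

/-- All nodes have set their flags. -/
def flagged (s : (oneRound hψ D hr).Config) : Prop := ∀ v, (s.1 v).1 = true

open Classical in
/-- The state after the communication, conditioned on the event that all flags are set. -/
def flaggedState (inp : Fin (r + 1) → Option (BitString n)) (φ : (oneRound hψ D hr).Certs → ℂ) :
    (oneRound hψ D hr).Config → ℂ := fun s =>
  if flagged hψ D hr s then ((oneRound hψ D hr).globalPrep inp *ᵥ φ) s else 0

lemma flaggedState_relation (inp : Fin (r + 1) → Option (BitString n))
    (φ : (oneRound hψ D hr).Certs → ℂ) (v : Fin (r + 1)) {s s' : (oneRound hψ D hr).Config}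
    {c c' : ℂ} (hs : ∀ u, u ≠ v → (oneRound hψ D hr).outEquiv s u = (oneRound hψ D hr).outEquiv s' u)
    (hf : (s.1 v).1 = (s'.1 v).1)
    (h : ∀ z, c * nodeProj ψ D v (inp v) (outNodeEquiv m v ((oneRound hψ D hr).outEquiv s v)).2 z =
      c' * nodeProj ψ D v (inp v) (outNodeEquiv m v ((oneRound hψ D hr).outEquiv s' v)).2 z) :
    c * flaggedState hψ D hr inp φ s = c' * flaggedState hψ D hr inp φ s' := by
  have hiff : flagged hψ D hr s ↔ flagged hψ D hr s' := by
    refine forall_congr' fun u => ?_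
    by_cases hu : u = v
    · rw [hu, hf]
    · have := congrArg (fun q => q.1.1) (hs u hu)
      exact Iff.of_eq (congrArg (· = true) this)
  unfold flaggedState
  by_cases hfl : flagged hψ D hr s
  · rw [if_pos hfl, if_pos (hiff.mp hfl)]
    refine (oneRound hψ D hr).globalPrep_mulVec_relation inp φ v hs fun z => ?_
    have e : ∀ t : (oneRound hψ D hr).Config, flagged hψ D hr t →
        (oneRound hψ D hr).prep v (inp v) ((oneRound hψ D hr).outEquiv t v) z =
        nodeProj ψ D v (inp v) (outNodeEquiv m v ((oneRound hψ D hr).outEquiv t v)).2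
          (pairEquiv m z) := fun t ht => if_pos (ht v)
    rw [e s hfl, e s' (hiff.mp hfl)]
    exact h _
  · rw [if_neg hfl, if_neg fun h' => hfl (hiff.mpr h'), mul_zero, mul_zero]

/-- Acceptance requires all flags, so discarding the unflagged part does not change the accepted
component. -/
lemma globalAccept_mulVec_flaggedState (inp : Fin (r + 1) → Option (BitString n))
    (φ : (oneRound hψ D hr).Certs → ℂ) :
    (oneRound hψ D hr).globalAccept inp *ᵥ flaggedState hψ D hr inp φ =
      (oneRound hψ D hr).globalAccept inp *ᵥ ((oneRound hψ D hr).globalPrep inp *ᵥ φ) := by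
  funext s
  refine Finset.sum_congr rfl fun s' _ => ?_
  unfold flaggedState
  split_ifs with h
  · rfl
  · obtain ⟨v, hv⟩ := not_forall.mp h
    have h0 : (oneRound hψ D hr).globalAccept inp s s' = 0 := by
      refine Finset.prod_eq_zero (Finset.mem_univ v) ?_
      exact flaggedSymProj_eq_zero (swapIn_flag m v) (by simpa using hv)
    change (oneRound hψ D hr).globalAccept inp s s' * 0 =
      (oneRound hψ D hr).globalAccept inp s s' * _
    rw [h0, zero_mul, zero_mul]

lemma flaggedState_swapOut {x y : BitString n} (φ : (oneRound hψ D hr).Certs → ℂ)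
    {v : Fin (r + 1)} (h0 : v ≠ 0) (hl : v ≠ Fin.last r) (s : (oneRound hψ D hr).Config) :
    flaggedState hψ D hr (pathInput x y) φ
      (factorPerm (oneRound hψ D hr).outEquiv v (swapOut m v) s) =
      flaggedState hψ D hr (pathInput x y) φ s := by
  have h := factorPerm_apply (oneRound hψ D hr).outEquiv v (swapOut m v) s
  have hv := congrFun h v
  rw [Function.update_self] at hv
  refine (one_mul _).symm.trans (Eq.trans ?_ (one_mul _))
  refine flaggedState_relation hψ D hr _ φ v (fun u hu => ?_) ?_ fun z => ?_
  · rw [h, Function.update_of_ne hu]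
  · exact congrArg (fun q => q.1.1) hv
  · have hq : outNodeEquiv m v ((oneRound hψ D hr).outEquiv
        (factorPerm (oneRound hψ D hr).outEquiv v (swapOut m v) s) v) =
        Prod.map id Prod.swap (outNodeEquiv m v ((oneRound hψ D hr).outEquiv s v)) := by
      rw [hv]
      exact (outNodeEquiv m v).apply_symm_apply _
    rw [hq, pathInput_of_ne x y h0 hl, one_mul, one_mul]
    exact symProj_apply_perm prodComm_involutive _ _

lemma flaggedState_putSent {x y : BitString n} (φ : (oneRound hψ D hr).Certs → ℂ)
    (s : (oneRound hψ D hr).Config) (c c' : QReg m) :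
    ψ x c' * flaggedState hψ D hr (pathInput x y) φ (putSent hψ D hr s c) =
      ψ x c * flaggedState hψ D hr (pathInput x y) φ (putSent hψ D hr s c') := by
  refine flaggedState_relation hψ D hr _ φ 0 (fun u hu => ?_) rfl fun z => ?_
  · change ((s.1 u, Function.update s.2 0 (fun _ => resize c) u) : _ × _) =
      (s.1 u, Function.update s.2 0 (fun _ => resize c') u)
    rw [Function.update_of_ne hu, Function.update_of_ne hu]
  · have hq : ∀ d, (outNodeEquiv m 0 ((oneRound hψ D hr).outEquiv (putSent hψ D hr s d) 0)).2 =
        ((s.1 0).2, d) := fun d => Prod.ext rfl (sent_putSent hψ D hr s d)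
    rw [hq, hq, pathInput_zero]
    simp only [nodeProj, if_true, startProj, Matrix.of_apply]
    split_ifs
    · ring
    · simp

lemma kept_mem_of_flaggedState_ne_zero {x y : BitString n} (φ : (oneRound hψ D hr).Certs → ℂ)
    (s : (oneRound hψ D hr).Config) (hs : flaggedState hψ D hr (pathInput x y) φ s ≠ 0) :
    kept hψ D hr (Fin.last r) s ∈ D y := by
  by_contra hmem
  refine hs ?_
  have h0 : Fin.last r ≠ 0 := fun h => by
    have := congrArg Fin.val h
    simp at this
    omega
  -- With `c = 1` and `c' = 0` the relation says that the amplitude is zero.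
  have := flaggedState_relation hψ D hr (pathInput x y) φ (Fin.last r) (s := s) (s' := s) (c := 1)
    (c' := 0) (fun _ _ => rfl) rfl fun z => by
      rw [pathInput_last hr, zero_mul, one_mul]
      simp only [nodeProj, if_neg h0, finishProj, Matrix.diagonal_apply]
      split_ifs with h1 h2
      · exact absurd h2 hmem
      · rfl
      · rfl
  simpa using this

lemma oneRound_sound {x y : BitString n} (hxy : ∑ a ∈ D y, ‖ψ x a‖ ^ 2 ≤ 1 / 4) :
    (((1 - 1 / (16 * (r : ℝ) ^ 2) : ℝ) : ℂ) • 1 -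
      (oneRound hψ D hr).acceptOp (pathInput x y)).PosSemidef := by
  set P := oneRound hψ D hr with hP
  set inp := pathInput (r := r) x y
  set l : ℝ := 1 - 1 / (16 * (r : ℝ) ^ 2) with hl
  have hl0 : 0 ≤ l := by
    have : (1 : ℝ) ≤ r := by exact_mod_cast hr
    rw [hl, sub_nonneg, div_le_one (by positivity)]
    nlinarith
  have hG := P.globalAccept_conjTranspose inp fun v => acceptProj_conjTranspose m v
  have hGG := P.globalAccept_mul_self inp fun v => acceptProj_mul_self m v
  refine Matrix.PosSemidef.of_dotProduct_mulVec_nonneg ?_ fun φ => ?_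
  · refine Matrix.IsHermitian.sub ?_ (P.acceptOp_posSemidef inp).1
    rw [Matrix.IsHermitian, Matrix.conjTranspose_smul, Matrix.conjTranspose_one]
    simp
  have hpath := l2norm_projection_sq_le_of_path hr hG hGG
    (Ψ := flaggedState hψ D hr inp φ) (a := kept hψ D hr) (b := sent hψ D hr)
    (T := fun j => factorPerm P.inEquiv j.succ (swapIn m j.succ))
    (U := fun v => factorPerm P.outEquiv v (swapOut m v)) (ψ := ψ x) (D := D y)
    (put := putSent hψ D hr)
    (sent_factorPerm_swapIn hψ D hr)
    (fun j => P.globalAccept_factorPerm inp j.succ _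
      (flaggedSymProj_apply_perm (swapIn_involutive m j.succ) (swapIn_flag m j.succ)))
    (kept_factorPerm_swapOut hψ D hr)
    (fun v h0 hl => flaggedState_swapOut hψ D hr φ h0 hl)
    (sent_putSent hψ D hr) (putSent_putSent hψ D hr) (flaggedState_putSent hψ D hr φ)
    (hψ x) hxy (kept_mem_of_flaggedState_ne_zero hψ D hr φ)
  rw [globalAccept_mulVec_flaggedState] at hpath
  have hflag : l2norm (flaggedState hψ D hr inp φ) ≤ l2norm φ := by
    rw [← l2norm_mulVec_isometry (P.globalPrep_isometry inp)]
    refine l2norm_le_of_norm_le fun s => ?_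
    unfold flaggedState
    split_ifs
    · exact le_rfl
    · simp
  have hfinal : l2norm (P.globalAccept inp *ᵥ (P.globalPrep inp *ᵥ φ)) ^ 2 ≤ l * l2norm φ ^ 2 :=
    hpath.trans (mul_le_mul_of_nonneg_left
      (pow_le_pow_left₀ (l2norm_nonneg _) hflag 2) hl0)
  rw [Matrix.sub_mulVec, dotProduct_sub, Matrix.smul_mulVec, Matrix.one_mulVec, dotProduct_smul,
    star_dotProduct_self_eq, P.star_dotProduct_acceptOp,
    star_dotProduct_mulVec_of_projection hG hGG, smul_eq_mul, ← Complex.ofReal_mul,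
    ← Complex.ofReal_sub]
  exact_mod_cast sub_nonneg.mpr hfinal

end PathProtocol

/-! ### Fingerprints for the Hamming distance. -/

/-- A string within `d + 1` of `y` arises from one within `d` by flipping one bit or none, which
leaves `n + 1` choices. -/
lemma card_hammingBall_le {n : ℕ} (y : BitString n) (d : ℕ) :
    (Finset.univ.filter fun y' => hammingDist y' y ≤ d).card ≤ (n + 1) ^ d := by
  induction d with
  | zero => simp [Finset.filter_eq']
  | succ d ih =>
    let flip : Option (Fin n) → BitString n → BitString n := fun o z =>
      o.elim z fun i => Function.update z i (!z i)
    have hsub : (Finset.univ.filter fun y' => hammingDist y' y ≤ d + 1) ⊆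
        (Finset.univ : Finset (Option (Fin n))).biUnion fun o =>
          (Finset.univ.filter fun y' => hammingDist y' y ≤ d).image (flip o) := by
      intro z hz
      simp only [Finset.mem_filter, Finset.mem_univ, true_and] at hz
      simp only [Finset.mem_biUnion, Finset.mem_univ, true_and, Finset.mem_image,
        Finset.mem_filter]
      by_cases hzy : z = y
      · exact ⟨none, z, by simp [hzy], rfl⟩
      · obtain ⟨i, hi⟩ := Function.ne_iff.mp hzy
        refine ⟨some i, Function.update z i (y i), ?_, ?_⟩
        · have hlt : hammingDist (Function.update z i (y i)) y < hammingDist z y := by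
            refine Finset.card_lt_card (Finset.ssubset_iff.mpr ⟨i, by simp, ?_⟩)
            intro j hj
            simp only [Finset.mem_insert, Finset.mem_filter, Finset.mem_univ, true_and] at hj ⊢
            rcases hj with rfl | hj
            · exact hi
            · by_cases hji : j = i
              · exact absurd (by simp [hji]) hj
              · rwa [Function.update_of_ne hji] at hj
          omega
        · have : (!y i) = z i := by cases h1 : y i <;> cases h2 : z i <;> simp_all
          simp [flip, this]
    calc _ ≤ _ := Finset.card_le_card hsub
      _ ≤ _ := Finset.card_biUnion_le
      _ ≤ ∑ _o : Option (Fin n), (n + 1) ^ d :=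
        Finset.sum_le_sum fun o _ => Finset.card_image_le.trans ih
      _ = (n + 1) ^ (d + 1) := by simp [pow_succ, mul_comm]

/-- The polynomial hash function with seed `s`. -/
def polyHash {n p : ℕ} (s : ZMod p) (x : BitString n) : ZMod p :=
  ∑ i : Fin n, if x i then s ^ (i : ℕ) else 0

/-- Colliding seeds are roots of the difference polynomial, which is nonzero because some
coefficient is `±1`. -/
lemma card_polyHash_eq_le {n p : ℕ} [Fact p.Prime] {x y : BitString n} (hxy : x ≠ y) :
    (Finset.univ.filter fun s : ZMod p => polyHash s x = polyHash s y).card ≤ n := by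
  let c : Fin n → ZMod p := fun i => (if x i then 1 else 0) - (if y i then 1 else 0)
  let q : Polynomial (ZMod p) := ∑ i : Fin n, Polynomial.C (c i) * Polynomial.X ^ (i : ℕ)
  obtain ⟨i, hi⟩ := Function.ne_iff.mp hxy
  have hcoeff : q.coeff i = c i := by
    simp [q, Polynomial.coeff_X_pow, Fin.val_inj]
  have hq : q ≠ 0 := by
    intro h0
    rw [h0, Polynomial.coeff_zero] at hcoeff
    revert hcoeff hi
    cases h1 : x i <;> cases h2 : y i <;> simp [c, h1, h2]
  have hdeg : q.natDegree ≤ n :=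
    Polynomial.natDegree_sum_le_of_forall_le _ _ fun j _ =>
      (Polynomial.natDegree_C_mul_X_pow_le _ _).trans j.2.le
  refine le_trans ?_ hdeg
  refine Polynomial.card_le_degree_of_subset_roots fun s hs => ?_
  have hs' : polyHash s x = polyHash s y := by simpa using hs
  rw [Polynomial.mem_roots hq, Polynomial.IsRoot.def]
  have : q.eval s = polyHash s x - polyHash s y := by
    simp only [q, c, polyHash, Polynomial.eval_finsetSum, ← Finset.sum_sub_distrib]
    refine Finset.sum_congr rfl fun j _ => ?_
    cases x j <;> cases y j <;> simp
  rw [this, hs', sub_self]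

/-- Fingerprints for the Hamming distance function: pure states `ψ x` of `m` qubits and sets `D y`
of basis states such that a measurement of `ψ x` in the computational basis is always in `D y`
if `x` and `y` are close, and rarely if they are not. -/
lemma exists_hamming_fingerprint (d n : ℕ) :
    ∃ m : ℕ, m = 2 * (d + 3) * (Nat.clog 2 n + 1) ∧
      ∃ (ψ : BitString n → QReg m → ℂ) (D : BitString n → Finset (QReg m)),
        (∀ x, ∑ a, ‖ψ x a‖ ^ 2 = 1) ∧
        (∀ x y, HAM n d x y = true → ∀ a, ψ x a ≠ 0 → a ∈ D y) ∧
        (∀ x y, HAM n d x y = false → ∑ a ∈ D y, ‖ψ x a‖ ^ 2 ≤ 1 / 4) := by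
  classical
  refine ⟨_, rfl, ?_⟩
  set t := Nat.clog 2 n
  set m := 2 * (d + 3) * (t + 1)
  have hnt : n ≤ 2 ^ t := Nat.le_pow_clog one_lt_two n
  -- Bertrand's postulate: `p` exceeds `4n(n+1)^d`, which makes the union bound at most 1/4, yet
  -- `p²` fits in `2^m`. Using `2^t` for `n` keeps the bound positive when `n = 0`.
  obtain ⟨p, hp, hBp, hpB⟩ := Nat.exists_prime_lt_and_le_two_mul (4 * (2 ^ t * (n + 1) ^ d))
    (by positivity)
  have : Fact p.Prime := ⟨hp⟩
  have hp0 : (0 : ℝ) < p := by exact_mod_cast hp.pos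
  have hpm : p * p ≤ 2 ^ m := by
    have h1 : n + 1 ≤ 2 ^ (t + 1) := by
      have := Nat.one_le_two_pow (n := t)
      rw [pow_succ]; omega
    have h2 : p ≤ 2 ^ ((d + 3) * (t + 1)) := by
      calc p ≤ 2 * (4 * (2 ^ t * (n + 1) ^ d)) := hpB
        _ ≤ 2 * (4 * (2 ^ t * (2 ^ (t + 1)) ^ d)) := by gcongr
        _ = 2 ^ (3 + t + (t + 1) * d) := by rw [← pow_mul]; ring
        _ ≤ 2 ^ ((d + 3) * (t + 1)) := Nat.pow_le_pow_right two_pos (by nlinarith)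
    calc p * p ≤ 2 ^ ((d + 3) * (t + 1)) * 2 ^ ((d + 3) * (t + 1)) := Nat.mul_le_mul h2 h2
      _ = 2 ^ m := by rw [← pow_add]; congr 1; simp only [m]; ring
  obtain ⟨enc⟩ : Nonempty (ZMod p × ZMod p ↪ QReg m) :=
    Function.Embedding.nonempty_of_card_le (by simpa [ZMod.card] using hpm)
  let g : BitString n → ZMod p → QReg m := fun x s => enc (s, polyHash s x)
  have hg : ∀ x, Function.Injective (g x) := fun x s s' h =>
    (Prod.mk.inj (enc.injective h)).1
  let ψ : BitString n → QReg m → ℂ := fun x a =>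
    if a ∈ Finset.univ.image (g x) then ((Real.sqrt p)⁻¹ : ℝ) else 0
  have hψ : ∀ x (T : Finset (QReg m)), ∑ a ∈ T, ‖ψ x a‖ ^ 2 =
      ((T.filter fun a => a ∈ Finset.univ.image (g x)).card : ℝ) / p := by
    intro x T
    have h1 : ∀ a, ‖ψ x a‖ ^ 2 = if a ∈ Finset.univ.image (g x) then (p : ℝ)⁻¹ else 0 := by
      intro a
      simp only [ψ]
      split_ifs
      · rw [Complex.norm_real, Real.norm_eq_abs, sq_abs, inv_pow, Real.sq_sqrt hp0.le]
      · simp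
    simp only [h1]
    rw [← Finset.sum_filter, Finset.sum_const, nsmul_eq_mul, div_eq_mul_inv]
  let D : BitString n → Finset (QReg m) := fun y =>
    (Finset.univ.filter fun e : ZMod p × ZMod p =>
      ∃ y', hammingDist y' y ≤ d ∧ polyHash e.1 y' = e.2).map enc
  have hD : ∀ x y s, g x s ∈ D y ↔ ∃ y', hammingDist y' y ≤ d ∧ polyHash s y' = polyHash s x := by
    intro x y s
    simp [D, g]
  refine ⟨ψ, D, fun x => ?_, fun x y hxy a ha => ?_, fun x y hxy => ?_⟩
  · rw [hψ, Finset.filter_mem_eq_inter, Finset.univ_inter,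
      Finset.card_image_of_injective _ (hg x), Finset.card_univ, ZMod.card, div_self hp0.ne']
  · have : a ∈ Finset.univ.image (g x) := by
      by_contra h
      exact ha (if_neg h)
    obtain ⟨s, -, rfl⟩ := Finset.mem_image.mp this
    exact (hD x y s).mpr ⟨x, of_decide_eq_true hxy, rfl⟩
  · have hxy' : ¬ hammingDist x y ≤ d := of_decide_eq_false hxy
    rw [hψ, div_le_iff₀ hp0]
    have h1 : ((D y).filter fun a => a ∈ Finset.univ.image (g x)) ⊆
        ((Finset.univ.filter fun y' => hammingDist y' y ≤ d).biUnion fun y' =>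
          Finset.univ.filter fun s : ZMod p => polyHash s y' = polyHash s x).image (g x) := by
      intro a ha
      obtain ⟨ha1, ha2⟩ := Finset.mem_filter.mp ha
      obtain ⟨s, -, rfl⟩ := Finset.mem_image.mp ha2
      refine Finset.mem_image_of_mem _ ?_
      simpa using (hD x y s).mp ha1
    have h2 : ((D y).filter fun a => a ∈ Finset.univ.image (g x)).card ≤ (n + 1) ^ d * n := by
      refine (Finset.card_le_card h1).trans (Finset.card_image_le.trans ?_)
      refine (Finset.card_biUnion_le_card_mul _ _ n fun y' hy' => ?_).trans
        (Nat.mul_le_mul_right n (card_hammingBall_le y d))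
      refine card_polyHash_eq_le ?_
      rintro rfl
      exact hxy' (Finset.mem_filter.mp hy').2
    have h3 : 4 * ((n + 1) ^ d * n) ≤ p := by
      refine le_trans ?_ hBp.le
      rw [mul_comm (2 ^ t)]
      gcongr
    have h4 : 4 * ((D y).filter fun a => a ∈ Finset.univ.image (g x)).card ≤ p := by omega
    have h5 : (4 : ℝ) * ((D y).filter fun a => a ∈ Finset.univ.image (g x)).card ≤ p := by
      exact_mod_cast h4
    linarith

/-! ### Numerical estimates and the conclusion. -/

lemma one_sub_inv_pow_le_third {r : ℕ} (hr : 1 ≤ r) :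
    (1 - 1 / (16 * (r : ℝ) ^ 2)) ^ (32 * r ^ 2) ≤ 1 / 3 := by
  have hr' : (1 : ℝ) ≤ r := by exact_mod_cast hr
  set t : ℝ := 1 / (16 * (r : ℝ) ^ 2) with ht
  have h0 : 0 ≤ 1 - t := by
    rw [ht, sub_nonneg, div_le_one (by positivity)]
    nlinarith
  calc (1 - t) ^ (32 * r ^ 2) ≤ Real.exp (-t) ^ (32 * r ^ 2) :=
        pow_le_pow_left₀ h0 (Real.one_sub_le_exp_neg t) _
    _ = Real.exp (-2) := by
        rw [← Real.exp_nat_mul]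
        congr 1
        rw [ht]
        push_cast
        field_simp
        norm_num
    _ ≤ 1 / 3 := by
        rw [Real.exp_neg, one_div]
        have := Real.add_one_le_exp (2 : ℝ)
        exact inv_anti₀ (by norm_num) (by linarith)

lemma clog_add_one_le {n : ℕ} (hn : 2 ≤ n) : ((Nat.clog 2 n : ℕ) : ℝ) + 1 ≤ 6 * Real.log n := by
  have h1 : 2 ^ (Nat.clog 2 n - 1) ≤ n := (Nat.pow_pred_clog_lt_self one_lt_two hn).le
  have hpos : 0 < Nat.clog 2 n := Nat.clog_pos one_lt_two hn
  have h2 : ((Nat.clog 2 n - 1 : ℕ) : ℝ) * Real.log 2 ≤ Real.log n := by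
    rw [← Real.log_pow]
    exact Real.log_le_log (by positivity) (by exact_mod_cast h1)
  have h3 : Real.log 2 ≤ Real.log n := Real.log_le_log two_pos (by exact_mod_cast hn)
  have h4 := Real.log_two_gt_d9
  rw [Nat.cast_sub hpos, Nat.cast_one] at h2
  nlinarith

lemma one_le_log_add {n r : ℕ} (hn : 2 ≤ n) (hr : 1 ≤ r) : 1 ≤ Real.log ((n : ℝ) + r) := by
  rw [Real.le_log_iff_exp_le (by positivity)]
  have h1 : (2 : ℝ) ≤ n := by exact_mod_cast hn
  have h2 : (1 : ℝ) ≤ r := by exact_mod_cast hr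
  linarith [Real.exp_one_lt_d9]

theorem mainTheorem7 (c : ℝ) (hc : 0 < c) (d : ℕ) (hd : 0 < d) :
    ∃ C : ℝ, 0 < C ∧ ∀ n r : ℕ, 1 ≤ n → 1 ≤ r →
      ∃ P : DQMAProtocol (SimpleGraph.pathGraph (r + 1)) (Option (BitString n)),
        IsDQMAOnPath P (HAM n d) (1 - 1 / (n : ℝ) ^ c) (1 / 3) ∧
        (∀ v, (P.certSize v : ℝ) ≤
          C * ((r : ℝ) ^ 2 * Real.log n * Real.log (n + r))) ∧
        (∀ u v, (P.msgSize u v : ℝ) ≤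
          C * ((r : ℝ) ^ 2 * Real.log n * Real.log (n + r))) := by
  -- A certificate has `32r² · 2m = 128(d+3)r²(clog n + 1)` qubits, and `clog n + 1 ≤ 6 log n` gives
  -- 768. The factor `log(n+r) ≥ 1` is slack.
  refine ⟨768 * (d + 3), by positivity, fun n r hn hr => ?_⟩
  obtain ⟨m, hm, ψ, D, hψ, hclose, hfar⟩ := exists_hamming_fingerprint d n
  have hcomplete : ∀ k x y, HAM n d x y = true → ∃ ρ, IsDensityMatrix ρ ∧
      1 - 1 / (n : ℝ) ^ c ≤
        ((PathProtocol.oneRound hψ D hr).parallel k).acceptProb (pathInput x y) ρ := by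
    intro k x y hxy
    obtain ⟨φ, hφ, hfix⟩ := PathProtocol.oneRound_complete hψ D hr (hclose x y hxy)
    obtain ⟨ρ, hρ, h1⟩ := DQMAProtocol.parallel_exists_acceptProb_eq_one _ k _ hφ hfix
    refine ⟨ρ, hρ, ?_⟩
    rw [h1]
    have : 0 ≤ 1 / (n : ℝ) ^ c := by positivity
    linarith
  -- For `n = 1` the size bound is zero; since `d ≥ 1` the function is constantly 1, and zero rounds
  -- suffice.
  rcases hn.eq_or_lt with rfl | hn2
  · refine ⟨(PathProtocol.oneRound hψ D hr).parallel 0,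
      fun x y => ⟨hcomplete 0 x y, fun hxy => ?_⟩, fun v => ?_, fun u v => ?_⟩
    · have h1 : ¬ hammingDist x y ≤ d := of_decide_eq_false hxy
      have h2 : hammingDist x y ≤ 1 := by simpa using hammingDist_le_card_fintype (x := x) (y := y)
      omega
    · simp [DQMAProtocol.parallel]
    · simp [DQMAProtocol.parallel]
  · have hbound : ((32 * r ^ 2 * (2 * m) : ℕ) : ℝ) ≤
        768 * (d + 3) * ((r : ℝ) ^ 2 * Real.log n * Real.log (n + r)) := by
      have h1 := clog_add_one_le hn2
      have h2 := one_le_log_add hn2 hr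
      have h3 : 0 ≤ Real.log n := Real.log_natCast_nonneg n
      rw [hm]
      push_cast
      calc 32 * (r : ℝ) ^ 2 * (2 * (2 * ((d : ℝ) + 3) * ((Nat.clog 2 n : ℝ) + 1)))
          = 128 * (d + 3) * ((r : ℝ) ^ 2 * ((Nat.clog 2 n : ℝ) + 1) * 1) := by ring
        _ ≤ 128 * (d + 3) * ((r : ℝ) ^ 2 * (6 * Real.log n) * Real.log (n + r)) := by
            gcongr
        _ = _ := by ring
    have hmsg : ∀ u v, PathProtocol.msgSize m u v ≤ 2 * m := fun u v : Fin (r + 1) =>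
      (PathProtocol.msgSize_le m u v).trans (by omega)
    refine ⟨(PathProtocol.oneRound hψ D hr).parallel (32 * r ^ 2),
      fun x y => ⟨hcomplete _ x y, fun hxy ρ hρ => ?_⟩, fun v => hbound, fun u v => ?_⟩
    · exact (DQMAProtocol.parallel_acceptProb_le _ _ _
        (PathProtocol.oneRound_sound hψ D hr (hfar x y hxy)) hρ).trans (one_sub_inv_pow_le_third hr)
    · refine le_trans ?_ hbound
      exact_mod_cast Nat.mul_le_mul_left (32 * r ^ 2) (hmsg u v)

end
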